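/- For $n\in\mathbb{N}$ let $F_n$ be the free group with basis $a_1,\dots,a_n$. A subgroup $H\le F_n$ is a \emph{free factor} of $F_n$ if there is a subgroup $K\le F_n$ such that the canonical homomorphism $H * K\to F_n$ is an isomorphism. \textbf{Theorem.} The following problem is decidable: given a rank $n$, an element $u\in F_n$ and a finitely generated subgroup $H\le F_n$ that is cyclic or a free factor of $F_n$, does there exist an automorphism $\varphi\in\operatorname{Aut}(F_n)$ with $\varphi(u)\in H$? That is, there is one algorithm (a partial recursive function) that takes as input a number $n$, a word $u$ in the letters $a_i^{\pm1}$ ($1\le i\le n$) and a finite list of such words generating $H$ (none of them necessarily reduced), and that, whenever $H$ is cyclic (possibly trivial) or a free factor of $F_n$, halts and answers correctly whether $\varphi(u)\in H$ for some $\varphi\in\operatorname{Aut}(F_n)$. -/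

import Mathlib

/-- `H` is a free factor of `G`: there is a subgroup `K` such that `G` is the (internal) free
product of `H` and `K`, i.e. the canonical homomorphism `H ∗ K → G` is an isomorphism. -/
def IsFreeFactor {G : Type*} [Group G] (H : Subgroup G) : Prop :=
  ∃ K : Subgroup G, Function.Bijective (Monoid.Coprod.lift H.subtype K.subtype)

/-- Group words over the alphabet `{0, …, n - 1}`, not necessarily reduced: `(i, true)` is the
letter `i` and `(i, false)` is its formal inverse. The element of the free group on
`{0, …, n - 1}` represented by the word `w` is `FreeGroup.mk w`. -/
abbrev GroupWord (n : ℕ) : Type := List (Fin n × Bool)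

/-- A group word written on the tape: the same word, with its letters read as natural numbers. -/
def GroupWord.code {n : ℕ} (w : GroupWord n) : List (ℕ × Bool) :=
  w.map fun p => ((p.1 : ℕ), p.2)

/-- The subgroup generated by the elements that the words of a finite list represent. -/
def subgroupOf {n : ℕ} (gens : List (GroupWord n)) : Subgroup (FreeGroup (Fin n)) :=
  Subgroup.closure {x | ∃ w ∈ gens, x = FreeGroup.mk w}

/-- The instances handled by the algorithm: a rank, a group word, and a finite list of group
words. -/
abbrev OrbitInput : Type := ℕ × List (ℕ × Bool) × List (List (ℕ × Bool))

/-- The input that presents the rank `n`, the element of the free group represented by `u`, and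
the subgroup generated by the elements that the words in `gens` represent. -/
def orbitInput (n : ℕ) (u : GroupWord n) (gens : List (GroupWord n)) : OrbitInput :=
  (n, u.code, gens.map GroupWord.code)

/-! Whitehead's peak reduction is proved in a form that controls each generator separately, and the
decision procedure is read off from it.

A basis of the free group is an isomorphism `e : FreeGroup α ≃* G`; deleting an edge of its Cayley
tree cuts `G` into two half-spaces. The number of occurrences of a generator in the `e`-word of `u`
equals the number of pairs `(g, g * u)` separated by its half-space (`encard_separated_halfSpace`).
This quantity makes sense for any subset of `G`, so half-spaces of two bases `e` and `f` can be
compared and cut along each other. If some of them cross, a lightest arm is chosen and an innermost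
half-space is cut along it; the result is a Whitehead move that makes no generator more frequent and
lowers the number of crossings (`exists_move_of_crosses`). If none cross, a lightest half-space
belonging to only one basis is exchanged into the other (`exists_move_of_nested`). Thus `e` and `f`
both descend, with no generator ever occurring more often, to bases that agree up to order and
inversion (`exists_common_descent`).

Two consequences are used. Elements of one orbit are linked by small automorphisms without exceeding
the larger of their norms (`links_of_apply_eq`), so membership in an orbit can be tested in a finite
set of words. If the orbit of `x` meets a subgroup generated by letters, it does so at an element
linked to `x` within the norm of `x`, because letters that are absent stay absent during descent
(`exists_links_of_letters_mem`).

A free factor is carried to a subgroup generated by letters by some automorphism, and the second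
consequence applies. In a cyclic subgroup generated by `g`, an equation `φ u = g ^ k` says that `u`
is a `k`-th power; if `g ≠ 1`, then `|k|` is at most the length of `u`, and only finitely many
powers have to be tested against the orbit.

The algorithm searches for a certificate. A positive one is an automorphism with a word in the
generators of `H`. A negative one is a finite list of words containing `u`, closed under small
automorphisms up to a length bound, and missing the targets. Certificates are checked primitive
recursively and are sound for every `H`; being cyclic or a free factor is needed only for a negative
one to exist. -/

set_option linter.unusedSectionVars false

open scoped Pointwise

/-! ### Half-spaces of Cayley trees and crossing. -/

section HalfSpaces

variable {α G : Type*} [DecidableEq α] [Group G]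

/-- The formal inverse of a letter. -/
def letterInv (l : α × Bool) : α × Bool := (l.1, !l.2)

@[simp] theorem letterInv_letterInv (l : α × Bool) : letterInv (letterInv l) = l := by
  simp [letterInv]

@[simp] theorem letterInv_fst (l : α × Bool) : (letterInv l).1 = l.1 := rfl

theorem letterInv_ne (l : α × Bool) : letterInv l ≠ l := by
  intro h; have := congrArg Prod.snd h; simp [letterInv] at this

theorem eq_or_eq_letterInv {l m : α × Bool} (h : l.1 = m.1) : l = m ∨ l = letterInv m := by
  obtain ⟨i, b⟩ := l; obtain ⟨j, c⟩ := m
  cases b <;> cases c <;> simp_all [letterInv]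

/-- The element of the free group given by a letter. -/
def letter (l : α × Bool) : FreeGroup α := FreeGroup.mk [l]

theorem letter_letterInv (l : α × Bool) : letter (letterInv l) = (letter l)⁻¹ := by
  simp [letter, letterInv, FreeGroup.invRev]

theorem letter_mul_mk (l : α × Bool) (L : List (α × Bool)) :
    letter l * FreeGroup.mk L = FreeGroup.mk (l :: L) := by
  simp [letter]

theorem mk_mul_letter (l : α × Bool) (L : List (α × Bool)) :
    FreeGroup.mk L * letter l = FreeGroup.mk (L ++ [l]) := by
  simp [letter]

theorem toWord_letter (l : α × Bool) : (letter l).toWord = [l] := by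
  simp [letter]

theorem head?_toWord_inv (h : FreeGroup α) :
    h⁻¹.toWord.head? = h.toWord.getLast?.map letterInv := by
  rw [FreeGroup.toWord_inv]
  simp [FreeGroup.invRev, List.head?_reverse]
  rfl

theorem toWord_mul_of_isReduced {h f : FreeGroup α}
    (hr : FreeGroup.IsReduced (h.toWord ++ f.toWord)) :
    (h * f).toWord = h.toWord ++ f.toWord := by
  rw [FreeGroup.toWord_mul, hr.reduce_eq]

/-- The edge of the Cayley tree from `h` to `h * letter l` separates `1` from `u`, and is directed
towards `u`, if and only if it lies on the path spelled by the reduced word of `u`. -/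
theorem prefix_toWord_iff (h u : FreeGroup α) (l : α × Bool) :
    (h⁻¹.toWord.head? ≠ some l ∧ (h⁻¹ * u).toWord.head? = some l) ↔
      h.toWord ++ [l] <+: u.toWord := by
  constructor
  · rintro ⟨h1, h2⟩
    set f := h⁻¹ * u with hf
    have hu : u = h * f := by simp [hf]
    have hred : FreeGroup.IsReduced (h.toWord ++ f.toWord) := by
      refine List.isChain_append.2 ⟨FreeGroup.isReduced_toWord, FreeGroup.isReduced_toWord, ?_⟩
      intro x hx y hy
      rw [h2] at hy
      obtain rfl : l = y := by simpa using hy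
      intro hxy
      by_contra hne
      apply h1
      rw [head?_toWord_inv, Option.mem_def.1 hx]
      simp only [Option.map_some, Option.some.injEq]
      rcases eq_or_eq_letterInv hxy with rfl | rfl
      · exact absurd rfl hne
      · simp
    rw [hu, toWord_mul_of_isReduced hred]
    obtain ⟨t, ht⟩ : ∃ t, f.toWord = l :: t := by
      cases hw : f.toWord with
      | nil => simp [hw] at h2
      | cons a t => simp [hw] at h2; exact ⟨t, by rw [h2]⟩
    rw [ht]
    exact ⟨t, by simp⟩
  · rintro ⟨t, ht⟩
    have hred : FreeGroup.IsReduced (h.toWord ++ [l] ++ t) := by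
      rw [ht]; exact FreeGroup.isReduced_toWord
    have hu : u = h * FreeGroup.mk (l :: t) := by
      rw [← FreeGroup.mk_toWord (x := u), ← ht]
      nth_rw 2 [← FreeGroup.mk_toWord (x := h)]
      simp
    have hlt : FreeGroup.IsReduced (l :: t) := hred.infix ⟨h.toWord, [], by simp⟩
    refine ⟨?_, ?_⟩
    · rw [head?_toWord_inv]
      intro hx
      obtain ⟨x, hx, hxl⟩ := Option.map_eq_some_iff.1 hx
      rw [List.append_assoc] at hred
      have := (List.isChain_append.1 hred).2.2 x hx l (by simp)
      rw [← hxl] at this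
      simp [letterInv] at this
    · rw [hu, inv_mul_cancel_left, FreeGroup.toWord_mk, hlt.reduce_eq]
      simp

/-- The elements of `G` whose reduced word in the basis `e` begins with the letter `l`. -/
def halfSpace (e : FreeGroup α ≃* G) (l : α × Bool) : Set G :=
  {g | (e.symm g).toWord.head? = some l}

/-- The half-spaces of the Cayley tree of the basis `e`. -/
def IsHalfSpace (e : FreeGroup α ≃* G) (A : Set G) : Prop :=
  ∃ (g : G) (l : α × Bool), A = g • halfSpace e l

variable (e : FreeGroup α ≃* G)

theorem one_notMem_halfSpace (l : α × Bool) : (1 : G) ∉ halfSpace e l := by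
  simp [halfSpace]

theorem exists_mem_halfSpace {g : G} (hg : g ≠ 1) : ∃ l, g ∈ halfSpace e l := by
  have : (e.symm g).toWord ≠ [] := by simpa using hg
  obtain ⟨l, t, h⟩ := List.exists_cons_of_ne_nil this
  exact ⟨l, by simp [halfSpace, h]⟩

variable {e}

theorem eq_of_mem_halfSpace {g : G} {l m : α × Bool} (hl : g ∈ halfSpace e l)
    (hm : g ∈ halfSpace e m) : l = m := by
  simp only [halfSpace, Set.mem_ofPred_eq] at hl hm
  rw [hl] at hm
  simpa using hm

variable (e)

theorem disjoint_halfSpace {l m : α × Bool} (h : l ≠ m) :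
    Disjoint (halfSpace e l) (halfSpace e m) :=
  Set.disjoint_left.2 fun _ h1 h2 => h (eq_of_mem_halfSpace h1 h2)

/-- Multiplying by `l` on the left prepends `l` to the reduced word unless that word begins with the
inverse letter; in that case the two cancel, and what remains cannot begin with `l`. This is what
makes the complement of a half-space a half-space. -/
theorem letter_mul_mem_halfSpace_iff (l : α × Bool) (g : G) :
    e (letter l) * g ∈ halfSpace e l ↔ g ∉ halfSpace e (letterInv l) := by
  have h := prefix_toWord_iff (letter (letterInv l)) (e.symm g) l
  have h' := prefix_toWord_iff 1 (e.symm g) (letterInv l)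
  simp only [letter_letterInv, inv_inv, toWord_letter] at h
  simp at h'
  simp only [halfSpace, Set.mem_ofPred_eq, map_mul, MulEquiv.symm_apply_apply]
  set w := e.symm g with hw
  constructor
  · intro h1 h2
    have hw' : w = letter (letterInv l) * (letter l * w) := by
      simp [letter_letterInv]
    obtain ⟨t, ht⟩ := h'.1 h2
    have : letter l * w = FreeGroup.mk t := by
      rw [← FreeGroup.mk_toWord (x := w), ← ht, List.singleton_append, ← letter_mul_mk,
        letter_letterInv, mul_inv_cancel_left]
    have hred : FreeGroup.IsReduced ([letterInv l] ++ t) := by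
      rw [ht]; exact FreeGroup.isReduced_toWord
    have hr := List.isChain_append.1 hred
    have ht' : (letter l * w).toWord = t := by
      rw [this, FreeGroup.toWord_mk, FreeGroup.IsReduced.reduce_eq hr.2.1]
    rw [ht'] at h1
    have := hr.2.2 (letterInv l) (by simp) l h1
    simp [letterInv] at this
  · intro h2
    have hred : FreeGroup.IsReduced ((letter l).toWord ++ w.toWord) := by
      rw [toWord_letter]
      refine List.isChain_append.2 ⟨by simp, FreeGroup.isReduced_toWord, ?_⟩
      intro x hx y hy hxy
      obtain rfl : l = x := by simpa using hx
      by_contra hne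
      apply h2
      rcases eq_or_eq_letterInv hxy.symm with rfl | rfl
      · exact absurd rfl hne
      · exact hy
    rw [toWord_mul_of_isReduced hred, toWord_letter]
    simp

theorem letter_smul_halfSpace (l : α × Bool) :
    e (letter l) • halfSpace e (letterInv l) = (halfSpace e l)ᶜ := by
  ext g
  rw [Set.mem_smul_set_iff_inv_smul_mem, smul_eq_mul, Set.mem_compl_iff]
  have := letter_mul_mem_halfSpace_iff e l ((e (letter l))⁻¹ * g)
  rw [mul_inv_cancel_left] at this
  tauto

theorem compl_smul_halfSpace (g : G) (l : α × Bool) :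
    (g • halfSpace e l)ᶜ = (g * e (letter l)) • halfSpace e (letterInv l) := by
  rw [mul_smul, letter_smul_halfSpace, Set.smul_set_compl]

/-- The half-spaces at the base point are characterized by their combinatorial properties. -/
theorem halfSpace_unique {D : α × Bool → Set G} (h1 : ∀ l, (1 : G) ∉ D l)
    (hd : ∀ l m, l ≠ m → Disjoint (D l) (D m))
    (hc : ∀ l g, g ∉ D (letterInv l) → e (letter l) * g ∈ D l) : D = halfSpace e := by
  -- Peel off the first letter: the tail lies in `D m` for its own first letter `m`, which is not
  -- the inverse of the letter removed, so disjointness allows `hc` to be applied. The reverse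
  -- inclusion holds since the half-spaces already exhaust all of `G` except `1`.
  have key : ∀ L : List (α × Bool), FreeGroup.IsReduced L → ∀ l ∈ L.head?,
      e (FreeGroup.mk L) ∈ D l := by
    intro L
    induction L with
    | nil => simp
    | cons a t ih =>
      intro hr l hl
      obtain rfl : a = l := by simpa using hl
      rw [← letter_mul_mk, map_mul]
      apply hc
      intro hmem
      have hr' := List.isChain_cons.1 hr
      cases ht : t.head? with
      | none =>
        obtain rfl : t = [] := by simpa using ht
        exact h1 _ (by simpa [← FreeGroup.one_eq_mk] using hmem)
      | some m =>
        have hm := ih hr'.2 m ht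
        have hne : m ≠ letterInv a := by
          rintro rfl
          have := hr'.1 _ ht
          simp [letterInv] at this
        exact Set.disjoint_left.1 (hd _ _ hne) hm hmem
  have sub : ∀ l g, g ∈ halfSpace e l → g ∈ D l := by
    intro l g hg
    have := key (e.symm g).toWord FreeGroup.isReduced_toWord l hg
    simpa [FreeGroup.mk_toWord] using this
  funext l
  ext g
  refine ⟨fun hg => ?_, sub l g⟩
  have hne : g ≠ 1 := by rintro rfl; exact h1 l hg
  obtain ⟨m, hm⟩ := exists_mem_halfSpace e hne
  by_cases hlm : l = m
  · rwa [hlm]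
  · exact absurd (sub m g hm) (Set.disjoint_left.1 (hd _ _ hlm) hg)

theorem letter_mem_halfSpace (l : α × Bool) : e (letter l) ∈ halfSpace e l := by
  have := (letter_mul_mem_halfSpace_iff e l 1).2 (one_notMem_halfSpace e _)
  simpa using this

theorem isHalfSpace_halfSpace (l : α × Bool) : IsHalfSpace e (halfSpace e l) :=
  ⟨1, l, by simp⟩

variable {e}

theorem IsHalfSpace.smul {A : Set G} (h : IsHalfSpace e A) (g : G) : IsHalfSpace e (g • A) := by
  obtain ⟨x, l, rfl⟩ := h
  exact ⟨g * x, l, by rw [mul_smul]⟩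

theorem isHalfSpace_smul_iff {A : Set G} (g : G) : IsHalfSpace e (g • A) ↔ IsHalfSpace e A :=
  ⟨fun h => by simpa using h.smul g⁻¹, fun h => h.smul g⟩

theorem IsHalfSpace.compl {A : Set G} (h : IsHalfSpace e A) : IsHalfSpace e Aᶜ := by
  obtain ⟨x, l, rfl⟩ := h
  exact ⟨_, _, compl_smul_halfSpace e x l⟩

theorem isHalfSpace_compl_iff {A : Set G} : IsHalfSpace e Aᶜ ↔ IsHalfSpace e A :=
  ⟨fun h => by simpa using h.compl, fun h => h.compl⟩

variable (e)

/-- The elements whose reduced word in the basis `e` begins with `p`. -/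
def cylinder (p : List (α × Bool)) : Set G := {g | p <+: (e.symm g).toWord}

theorem smul_halfSpace_eq_cylinder {g : G} {l : α × Bool} (h : (1 : G) ∉ g • halfSpace e l) :
    g • halfSpace e l = cylinder e ((e.symm g).toWord ++ [l]) := by
  ext f
  rw [Set.mem_smul_set_iff_inv_smul_mem, smul_eq_mul] at h ⊢
  simp only [cylinder, Set.mem_ofPred_eq, ← prefix_toWord_iff]
  simp only [halfSpace, Set.mem_ofPred_eq, mul_one] at h ⊢
  simp only [map_mul, map_inv] at h ⊢
  tauto

/-- Two half-spaces of a tree which do not contain the base point are nested or disjoint. -/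
theorem subset_or_subset_or_disjoint_of_one_notMem {A B : Set G} (hA : IsHalfSpace e A)
    (hB : IsHalfSpace e B) (h1 : (1 : G) ∉ A) (h2 : (1 : G) ∉ B) :
    A ⊆ B ∨ B ⊆ A ∨ Disjoint A B := by
  obtain ⟨g, l, rfl⟩ := hA
  obtain ⟨h, m, rfl⟩ := hB
  rw [smul_halfSpace_eq_cylinder e h1, smul_halfSpace_eq_cylinder e h2]
  by_contra! hcon
  obtain ⟨hab, hba, hd⟩ := hcon
  obtain ⟨f, hf1, hf2⟩ := Set.not_disjoint_iff.1 hd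
  rcases List.prefix_or_prefix_of_prefix hf1 hf2 with h | h
  · exact hba fun x hx => h.trans hx
  · exact hab fun x hx => h.trans hx

/-- A half-space contained in no larger one avoiding the base point. -/
theorem subset_halfSpace_of_one_notMem {A : Set G} (hA : IsHalfSpace e A) (h1 : (1 : G) ∉ A) :
    ∃ l, A ⊆ halfSpace e l := by
  obtain ⟨g, l, rfl⟩ := hA
  rw [smul_halfSpace_eq_cylinder e h1]
  obtain ⟨m, hm⟩ : ∃ m, ((e.symm g).toWord ++ [l]).head? = some m := by
    cases (e.symm g).toWord <;> simp
  refine ⟨m, fun f hf => ?_⟩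
  obtain ⟨t, ht⟩ := hf
  simp only [halfSpace, Set.mem_ofPred_eq, ← ht]
  rw [List.head?_append, hm]; rfl

variable {e}

/-- The sets `A` and `B` cross: all four corners are nonempty. -/
def Crosses (A B : Set G) : Prop :=
  (A ∩ B).Nonempty ∧ (A ∩ Bᶜ).Nonempty ∧ (Aᶜ ∩ B).Nonempty ∧ (Aᶜ ∩ Bᶜ).Nonempty

theorem Crosses.symm {A B : Set G} (h : Crosses A B) : Crosses B A := by
  obtain ⟨h1, h2, h3, h4⟩ := h
  refine ⟨?_, ?_, ?_, ?_⟩ <;> rw [Set.inter_comm] <;> assumption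

theorem Crosses.compl_left {A B : Set G} (h : Crosses A B) : Crosses Aᶜ B := by
  obtain ⟨h1, h2, h3, h4⟩ := h
  exact ⟨h3, h4, by rwa [compl_compl], by rwa [compl_compl]⟩

theorem Crosses.compl_right {A B : Set G} (h : Crosses A B) : Crosses A Bᶜ :=
  h.symm.compl_left.symm

theorem crosses_compl_left_iff {A B : Set G} : Crosses Aᶜ B ↔ Crosses A B :=
  ⟨fun h => by simpa using h.compl_left, fun h => h.compl_left⟩

theorem crosses_compl_right_iff {A B : Set G} : Crosses A Bᶜ ↔ Crosses A B :=
  ⟨fun h => by simpa using h.compl_right, fun h => h.compl_right⟩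

theorem Crosses.smul {A B : Set G} (h : Crosses A B) (g : G) : Crosses (g • A) (g • B) := by
  obtain ⟨h1, h2, h3, h4⟩ := h
  simp only [Crosses, ← Set.smul_set_compl, ← Set.smul_set_inter, Set.smul_set_nonempty]
  exact ⟨h1, h2, h3, h4⟩

theorem crosses_smul_iff {A B : Set G} (g : G) : Crosses (g • A) (g • B) ↔ Crosses A B :=
  ⟨fun h => by simpa using h.smul g⁻¹, fun h => h.smul g⟩

theorem not_crosses_iff {A B : Set G} :
    ¬ Crosses A B ↔ A ⊆ Bᶜ ∨ A ⊆ B ∨ B ⊆ A ∨ Bᶜ ⊆ A := by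
  simp only [Crosses, not_and_or, Set.not_nonempty_iff_eq_empty, ← Set.disjoint_iff_inter_eq_empty]
  rw [Set.disjoint_compl_right_iff_subset, Set.disjoint_compl_left_iff_subset,
    ← Set.subset_compl_iff_disjoint_right, ← Set.subset_compl_iff_disjoint_right, compl_compl,
    Set.compl_subset_comm]

/-- The half-spaces of one tree do not cross. -/
theorem not_crosses_of_isHalfSpace {A B : Set G} (hA : IsHalfSpace e A) (hB : IsHalfSpace e B) :
    ¬ Crosses A B := by
  have key : ∀ {A B : Set G}, IsHalfSpace e A → IsHalfSpace e B → (1 : G) ∉ A → (1 : G) ∉ B →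
      ¬ Crosses A B := by
    intro A B hA hB h1 h2
    rw [not_crosses_iff]
    rcases subset_or_subset_or_disjoint_of_one_notMem e hA hB h1 h2 with h | h | h
    · tauto
    · tauto
    · exact Or.inl (Set.subset_compl_iff_disjoint_right.2 h)
  intro h
  by_cases h1 : (1 : G) ∈ A <;> by_cases h2 : (1 : G) ∈ B
  · exact key hA.compl hB.compl (by simpa) (by simpa) h.compl_left.compl_right
  · exact key hA.compl hB (by simpa) h2 h.compl_left
  · exact key hA hB.compl h1 (by simpa) h.compl_right
  · exact key hA hB h1 h2 h

end HalfSpaces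

/-! ### Occurrences of a generator as separated pairs. -/

section Counts

variable {α G : Type*} [DecidableEq α] [Group G]

/-- The number of occurrences of the `i`-th generator and its inverse in the reduced word of `u`
in the basis `e`. -/
def occurrences (e : FreeGroup α ≃* G) (u : G) (i : α) : ℕ :=
  (e.symm u).toWord.countP fun p => p.1 = i

/-- The pairs `(g, g * u)` separated by `A`. -/
def separated (u : G) (A : Set G) : Set G := {g | ¬ (g ∈ A ↔ g * u ∈ A)}

theorem separated_compl (u : G) (A : Set G) : separated u Aᶜ = separated u A := by
  ext g; simp [separated, not_iff_not]

theorem separated_smul (u : G) (A : Set G) (g : G) :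
    separated u (g • A) = g • separated u A := by
  ext x
  simp [separated, Set.mem_smul_set_iff_inv_smul_mem, mul_assoc]

theorem encard_smul_set' (g : G) (A : Set G) : (g • A).encard = A.encard :=
  (MulAction.injective g).encard_image A

theorem encard_separated_smul (u : G) (A : Set G) (g : G) :
    (separated u (g • A)).encard = (separated u A).encard := by
  rw [separated_smul, encard_smul_set']

/-- An occurrence of `l` is determined by the part of the word in front of it. -/
theorem encard_prefixes (W : List (α × Bool)) (l : α × Bool) :
    {p : List (α × Bool) | p ++ [l] <+: W}.encard = W.count l := by
  induction W using List.reverseRecOn with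
  | nil => simp
  | append_singleton W a ih =>
    by_cases h : a = l
    · subst h
      have : {p : List (α × Bool) | p ++ [a] <+: W ++ [a]} =
          insert W {p : List (α × Bool) | p ++ [a] <+: W} := by
        ext p
        simp [List.prefix_concat_iff]
      rw [this, Set.encard_insert_of_notMem, ih]
      · simp
      · intro hW
        have := List.IsPrefix.length_le hW
        simp at this
    · have : {p : List (α × Bool) | p ++ [l] <+: W ++ [a]} =
          {p : List (α × Bool) | p ++ [l] <+: W} := by
        ext p
        simp only [Set.mem_ofPred_eq, List.prefix_concat_iff, or_iff_right_iff_imp]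
        intro hp
        exact absurd (List.append_inj_right' hp rfl) (by simpa using Ne.symm h)
      rw [this, ih]
      simp [h]

variable (e : FreeGroup α ≃* G)

/-- The path from `g` to `g * u` enters the half-space exactly when the word of `g⁻¹` followed by
`l` is a prefix of the word of `u`; thus `g` corresponds to an occurrence of `l`. -/
theorem encard_entering (u : G) (l : α × Bool) :
    {g | g ∉ halfSpace e l ∧ g * u ∈ halfSpace e l}.encard = (e.symm u).toWord.count l := by
  rw [← encard_prefixes]
  have : {g | g ∉ halfSpace e l ∧ g * u ∈ halfSpace e l} =
      (fun p => (e (FreeGroup.mk p))⁻¹) ''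
        {p : List (α × Bool) | p ++ [l] <+: (e.symm u).toWord} := by
    ext g
    have h := prefix_toWord_iff (e.symm g)⁻¹ (e.symm u) l
    rw [inv_inv] at h
    simp only [halfSpace, Set.mem_ofPred_eq, Set.mem_image, map_mul]
    rw [← ne_eq, h]
    constructor
    · intro hp
      exact ⟨_, hp, by rw [FreeGroup.mk_toWord]; simp⟩
    · rintro ⟨p, hp, rfl⟩
      have hred : FreeGroup.IsReduced p :=
        (FreeGroup.isReduced_toWord (x := e.symm u)).infix
          ((List.prefix_append p [l]).trans hp).isInfix
      simpa [hred.reduce_eq] using hp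
  rw [this, Set.InjOn.encard_image]
  intro p hp q hq hpq
  have hred : ∀ p : List (α × Bool), p ++ [l] <+: (e.symm u).toWord → FreeGroup.IsReduced p :=
    fun p hp => (FreeGroup.isReduced_toWord (x := e.symm u)).infix
      ((List.prefix_append p [l]).trans hp).isInfix
  have h1 : FreeGroup.mk p = FreeGroup.mk q := by simpa using hpq
  have h2 := FreeGroup.reduce.sound h1
  rwa [(hred p hp).reduce_eq, (hred q hq).reduce_eq] at h2

/-- Entering the half-space accounts for the letter `l`. Leaving it is, after translation, entering
the half-space of the inverse letter, which accounts for the inverse occurrences. -/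
theorem encard_separated_halfSpace (u : G) (l : α × Bool) :
    (separated u (halfSpace e l)).encard = occurrences e u l.1 := by
  have h1 : separated u (halfSpace e l) =
      {g | g ∉ halfSpace e l ∧ g * u ∈ halfSpace e l} ∪
      e (letter l) • {g | g ∉ halfSpace e (letterInv l) ∧ g * u ∈ halfSpace e (letterInv l)} := by
    ext g
    have h := letter_mul_mem_halfSpace_iff e l ((e (letter l))⁻¹ * g)
    have h' := letter_mul_mem_halfSpace_iff e l ((e (letter l))⁻¹ * g * u)
    simp only [mul_assoc, mul_inv_cancel_left] at h h'
    simp only [separated, Set.mem_ofPred_eq, Set.mem_union, Set.mem_smul_set_iff_inv_smul_mem,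
      smul_eq_mul, mul_assoc]
    tauto
  rw [h1, Set.encard_union_eq, encard_smul_set', encard_entering, encard_entering, occurrences]
  · norm_cast
    generalize (e.symm u).toWord = W
    induction W with
    | nil => simp
    | cons a W ih =>
      rw [List.countP_cons, ← ih]
      obtain ⟨i, b⟩ := l
      obtain ⟨j, c⟩ := a
      by_cases hij : j = i
      · subst hij
        cases b <;> cases c <;> simp [letterInv] <;> omega
      · simp [letterInv, hij]
  · rw [Set.disjoint_left]
    intro g hg hg'
    have h := letter_mul_mem_halfSpace_iff e l ((e (letter l))⁻¹ * g)
    simp only [mul_inv_cancel_left] at h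
    rw [Set.mem_smul_set_iff_inv_smul_mem] at hg'
    exact hg.1 (h.2 hg'.1)

variable {e}

theorem IsHalfSpace.finite_separated {A : Set G} (h : IsHalfSpace e A) (u : G) :
    (separated u A).Finite := by
  obtain ⟨g, l, rfl⟩ := h
  rw [← Set.encard_lt_top_iff, encard_separated_smul, encard_separated_halfSpace]
  exact ENat.natCast_lt_top _

theorem norm_eq_sum_occurrences [Fintype α] (u : G) :
    (e.symm u).norm = ∑ i, occurrences e u i := by
  simp only [FreeGroup.norm, occurrences]
  generalize (e.symm u).toWord = W
  induction W with
  | nil => simp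
  | cons a W ih => simp [List.countP_cons, Finset.sum_add_distrib, ih]

theorem occurrences_eq_zero_iff (u : G) (i : α) :
    occurrences e u i = 0 ↔ ∀ p ∈ (e.symm u).toWord, p.1 ≠ i := by
  simp [occurrences, List.countP_eq_zero]

end Counts

/-! ### Whitehead automorphisms and their effect on half-spaces. -/

section WhiteheadMoves

variable {α G : Type*} [DecidableEq α] [Group G]

/-- Automorphisms which, like their inverses, send every generator to a word of length at most
three. -/
def IsSmall (ω : FreeGroup α ≃* FreeGroup α) : Prop :=
  ∀ i, (ω (FreeGroup.of i)).norm ≤ 3 ∧ (ω.symm (FreeGroup.of i)).norm ≤ 3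

theorem IsSmall.symm {ω : FreeGroup α ≃* FreeGroup α} (h : IsSmall ω) : IsSmall ω.symm :=
  fun i => ⟨(h i).2, (h i).1⟩

open Classical in
/-- The right multiplier of a letter in a Whitehead automorphism. -/
noncomputable def whiteheadFactor (P : Set (α × Bool)) (a m : α × Bool) : FreeGroup α :=
  if m ∈ P ∧ m.1 ≠ a.1 then letter a else 1

/-- The Whitehead endomorphism with multiplier `a` for the set of letters `P`. -/
noncomputable def whiteheadHom (P : Set (α × Bool)) (a : α × Bool) :
    FreeGroup α →* FreeGroup α :=
  FreeGroup.lift fun i =>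
    (whiteheadFactor P a (i, true))⁻¹ * FreeGroup.of i * whiteheadFactor P a (i, false)

/-- The inverse of the Whitehead endomorphism. -/
noncomputable def whiteheadInvHom (P : Set (α × Bool)) (a : α × Bool) :
    FreeGroup α →* FreeGroup α :=
  FreeGroup.lift fun i =>
    whiteheadFactor P a (i, true) * FreeGroup.of i * (whiteheadFactor P a (i, false))⁻¹

theorem letter_true (i : α) : letter (i, true) = FreeGroup.of i := rfl

theorem letter_false (i : α) : letter (i, false) = (FreeGroup.of i)⁻¹ := by
  rw [← letter_true, ← letter_letterInv]; rfl

variable (P : Set (α × Bool)) (a : α × Bool)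

theorem whiteheadHom_letter (m : α × Bool) :
    whiteheadHom P a (letter m) =
      (whiteheadFactor P a m)⁻¹ * letter m * whiteheadFactor P a (letterInv m) := by
  obtain ⟨i, b⟩ := m
  cases b
  · simp [letter_false, whiteheadHom, letterInv, mul_assoc]
  · simp [letter_true, whiteheadHom, letterInv]

theorem whiteheadInvHom_letter (m : α × Bool) :
    whiteheadInvHom P a (letter m) =
      whiteheadFactor P a m * letter m * (whiteheadFactor P a (letterInv m))⁻¹ := by
  obtain ⟨i, b⟩ := m
  cases b
  · simp [letter_false, whiteheadInvHom, letterInv, mul_assoc]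
  · simp [letter_true, whiteheadInvHom, letterInv]

theorem whiteheadFactor_of_fst_eq {m : α × Bool} (h : m.1 = a.1) : whiteheadFactor P a m = 1 := by
  simp [whiteheadFactor, h]

theorem whiteheadHom_factor (m : α × Bool) :
    whiteheadHom P a (whiteheadFactor P a m) = whiteheadFactor P a m := by
  rw [whiteheadFactor]
  split_ifs
  · rw [whiteheadHom_letter, whiteheadFactor_of_fst_eq P a rfl,
      whiteheadFactor_of_fst_eq P a (letterInv_fst a)]
    simp
  · simp

theorem whiteheadInvHom_factor (m : α × Bool) :
    whiteheadInvHom P a (whiteheadFactor P a m) = whiteheadFactor P a m := by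
  rw [whiteheadFactor]
  split_ifs
  · rw [whiteheadInvHom_letter, whiteheadFactor_of_fst_eq P a rfl,
      whiteheadFactor_of_fst_eq P a (letterInv_fst a)]
    simp
  · simp

/-- The Whitehead automorphism with multiplier `a` for the set of letters `P`. -/
noncomputable def whiteheadAut : FreeGroup α ≃* FreeGroup α :=
  MonoidHom.toMulEquiv (whiteheadHom P a) (whiteheadInvHom P a)
    (by
      ext i
      have h := whiteheadHom_letter P a (i, true)
      rw [letter_true] at h
      have h' := whiteheadInvHom_letter P a (i, true)
      rw [letter_true] at h'
      simp only [MonoidHom.comp_apply, h, h', map_mul, map_inv, whiteheadInvHom_factor]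
      simp [mul_assoc])
    (by
      ext i
      have h := whiteheadInvHom_letter P a (i, true)
      rw [letter_true] at h
      have h' := whiteheadHom_letter P a (i, true)
      rw [letter_true] at h'
      simp only [MonoidHom.comp_apply, h, h', map_mul, map_inv, whiteheadHom_factor]
      simp [mul_assoc])

theorem norm_whiteheadFactor_le (m : α × Bool) : (whiteheadFactor P a m).norm ≤ 1 := by
  rw [whiteheadFactor]
  split_ifs
  · simp [FreeGroup.norm, toWord_letter]
  · simp

theorem isSmall_whiteheadAut : IsSmall (whiteheadAut P a) := by
  intro i
  -- Each generator acquires at most one letter on either side, hence the bound three.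
  have h1 := norm_whiteheadFactor_le P a (i, true)
  have h2 := norm_whiteheadFactor_le P a (i, false)
  constructor
  · change (whiteheadHom P a (FreeGroup.of i)).norm ≤ 3
    rw [whiteheadHom, FreeGroup.lift_apply_of]
    refine (FreeGroup.norm_mul_le _ _).trans ?_
    have := FreeGroup.norm_mul_le (whiteheadFactor P a (i, true))⁻¹ (FreeGroup.of i)
    rw [FreeGroup.norm_inv_eq, FreeGroup.norm_of] at this
    omega
  · change (whiteheadInvHom P a (FreeGroup.of i)).norm ≤ 3
    rw [whiteheadInvHom, FreeGroup.lift_apply_of]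
    refine (FreeGroup.norm_mul_le _ _).trans ?_
    have := FreeGroup.norm_mul_le (whiteheadFactor P a (i, true)) (FreeGroup.of i)
    rw [FreeGroup.norm_of] at this
    rw [FreeGroup.norm_inv_eq]
    omega

variable {P a} (e : FreeGroup α ≃* G)

open Classical in
/-- The half-spaces at the base point after a Whitehead automorphism. -/
theorem halfSpace_whiteheadAut (ha : a ∈ P) (ha' : letterInv a ∉ P) :
    halfSpace ((whiteheadAut P a).trans e) = fun m =>
      if m = a then ⋃ m ∈ P, halfSpace e m
      else if m = letterInv a then (e (letter a))⁻¹ • (⋃ m ∈ P, halfSpace e m)ᶜ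
      else (e (whiteheadFactor P a m))⁻¹ • halfSpace e m := by
  symm
  set D := ⋃ m ∈ P, halfSpace e m with hD
  have haD : halfSpace e a ⊆ D := Set.subset_biUnion_of_mem ha
  -- An element outside the half-space of `a` does not lose a letter when multiplied by `a⁻¹` on the
  -- left.
  have hsub : ∀ A : Set G, Disjoint A (halfSpace e a) →
      (e (letter a))⁻¹ • A ⊆ halfSpace e (letterInv a) := by
    intro A hA g hg
    rw [Set.mem_smul_set_iff_inv_smul_mem, inv_inv] at hg
    by_contra hg'
    exact Set.disjoint_left.1 hA hg ((letter_mul_mem_halfSpace_iff e a g).2 hg')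
  have hDc : (e (letter a))⁻¹ • Dᶜ ⊆ halfSpace e (letterInv a) :=
    hsub _ (disjoint_compl_left.mono_right haD)
  have hfst : ∀ {m : α × Bool}, m ≠ a → m ≠ letterInv a → m.1 ≠ a.1 := by
    intro m h1 h2 h
    rcases eq_or_eq_letterInv h with h | h
    · exact h1 h
    · exact h2 h
  have hother : ∀ m, m ≠ a → m ≠ letterInv a →
      (m ∉ P ∧ (e (whiteheadFactor P a m))⁻¹ • halfSpace e m = halfSpace e m) ∨
      (m ∈ P ∧ (e (whiteheadFactor P a m))⁻¹ • halfSpace e m =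
        (e (letter a))⁻¹ • halfSpace e m) := by
    intro m h1 h2
    by_cases hm : m ∈ P
    · right; simp [whiteheadFactor, hm, hfst h1 h2]
    · left; simp [whiteheadFactor, hm]
  have hdisjD : ∀ m, m ∉ P → Disjoint (halfSpace e m) D := by
    intro m hm
    rw [hD, Set.disjoint_iUnion₂_right]
    intro m' hm'
    exact disjoint_halfSpace e (by rintro rfl; exact hm hm')
  -- The proposed sets are recognized by the three characteristic properties, so no reduced word in
  -- the new basis has to be computed.
  apply halfSpace_unique
  · intro m
    split_ifs with h1 h2
    · simp [hD, one_notMem_halfSpace]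
    · exact fun h => one_notMem_halfSpace e _ (hDc h)
    · rcases hother m h1 h2 with ⟨_, h⟩ | ⟨_, h⟩ <;> rw [h]
      · exact one_notMem_halfSpace e _
      · exact fun h' => one_notMem_halfSpace e _ (hsub _ (disjoint_halfSpace e h1) h')
  · have hsym : ∀ m m', m ≠ m' → (m' = a → m = a) → 
        (m' = letterInv a → m = a ∨ m = letterInv a) → Disjoint
        (if m = a then D else if m = letterInv a then (e (letter a))⁻¹ • Dᶜ
          else (e (whiteheadFactor P a m))⁻¹ • halfSpace e m)
        (if m' = a then D else if m' = letterInv a then (e (letter a))⁻¹ • Dᶜ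
          else (e (whiteheadFactor P a m'))⁻¹ • halfSpace e m') := by
      intro m m' hne hma hma'
      have h1' : m' ≠ a := fun h => hne ((hma h).trans h.symm)
      rw [if_neg h1']
      by_cases h1 : m = a
      · rw [if_pos h1]
        have : ∀ A : Set G, A ⊆ halfSpace e (letterInv a) → Disjoint D A := fun A hA =>
          ((hdisjD _ ha').mono_left hA).symm
        split_ifs with h2'
        · exact this _ hDc
        · rcases hother m' h1' h2' with ⟨hm, h⟩ | ⟨hm, h⟩ <;> rw [h]
          · exact (hdisjD _ hm).symm
          · exact this _ (hsub _ (disjoint_halfSpace e h1'))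
      · rw [if_neg h1]
        have h2' : m' ≠ letterInv a := fun h => by
          rcases hma' h with h' | h'
          · exact h1 h'
          · exact hne (h'.trans h.symm)
        rw [if_neg h2']
        split_ifs with h2
        · rcases hother m' h1' h2' with ⟨hm, h⟩ | ⟨hm, h⟩ <;> rw [h]
          · exact (disjoint_halfSpace e h2').symm.mono_left hDc
          · rw [Set.disjoint_smul_set]
            exact disjoint_compl_left.mono_right (Set.subset_biUnion_of_mem hm)
        · rcases hother m' h1' h2' with ⟨hm', h'⟩ | ⟨hm', h'⟩ <;> rw [h'] <;>
          rcases hother m h1 h2 with ⟨hm, h⟩ | ⟨hm, h⟩ <;> rw [h]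
          · exact disjoint_halfSpace e hne
          · exact (disjoint_halfSpace e h2').symm.mono_left (hsub _ (disjoint_halfSpace e h1))
          · exact (disjoint_halfSpace e h2).mono_right (hsub _ (disjoint_halfSpace e h1'))
          · rw [Set.disjoint_smul_set]
            exact disjoint_halfSpace e hne
    intro m m' hne
    by_cases h : (m' = a → m = a) ∧ (m' = letterInv a → m = a ∨ m = letterInv a)
    · exact hsym m m' hne h.1 h.2
    · refine (hsym m' m hne.symm ?_ ?_).symm
      · intro h1; by_contra h2; apply h; subst h1; simp
      · intro h1; by_contra h2; apply h; subst h1; tauto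
  · intro m g hg
    simp only [MulEquiv.trans_apply]
    have hw : whiteheadAut P a (letter m) =
      (whiteheadFactor P a m)⁻¹ * letter m * whiteheadFactor P a (letterInv m) :=
        whiteheadHom_letter P a m
    rw [hw]
    by_cases h1 : m = a
    · subst h1
      rw [if_pos rfl]
      rw [if_neg (letterInv_ne _), if_pos rfl, Set.mem_smul_set_iff_inv_smul_mem, inv_inv] at hg
      rw [whiteheadFactor_of_fst_eq P m rfl, whiteheadFactor_of_fst_eq P m (letterInv_fst m)]
      simpa using hg
    · rw [if_neg h1]
      by_cases h2 : m = letterInv a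
      · subst h2
        rw [letterInv_letterInv, if_pos rfl] at hg
        rw [if_pos rfl, Set.mem_smul_set_iff_inv_smul_mem, inv_inv, letterInv_letterInv,
          whiteheadFactor_of_fst_eq P a rfl, whiteheadFactor_of_fst_eq P a (letterInv_fst a)]
        simpa [letter_letterInv] using hg
      · rw [if_neg h2]
        rw [if_neg (fun h => h2 (by rw [← h, letterInv_letterInv])),
          if_neg (fun h => h1 (by rw [← letterInv_letterInv m, h, letterInv_letterInv])),
          Set.mem_smul_set_iff_inv_smul_mem, inv_inv] at hg
        rw [Set.mem_smul_set_iff_inv_smul_mem, inv_inv]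
        have := (letter_mul_mem_halfSpace_iff e m (e (whiteheadFactor P a (letterInv m)) * g)).2 hg
        simpa [mul_assoc] using this

/-- Replacing the half-space of the letter `a` by the union of the half-spaces of the letters in
`P`. -/
theorem exists_whitehead_move (ha : a ∈ P) (ha' : letterInv a ∉ P) :
    ∃ ω : FreeGroup α ≃* FreeGroup α, IsSmall ω ∧
      halfSpace (ω.trans e) a = ⋃ m ∈ P, halfSpace e m ∧
      ∀ m : α × Bool, m.1 ≠ a.1 → ∃ g : G, halfSpace (ω.trans e) m = g • halfSpace e m := by
  refine ⟨whiteheadAut P a, isSmall_whiteheadAut P a, ?_, ?_⟩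
  · rw [halfSpace_whiteheadAut e ha ha']; simp
  · intro m hm
    rw [halfSpace_whiteheadAut e ha ha']
    refine ⟨(e (whiteheadFactor P a m))⁻¹, ?_⟩
    have h1 : m ≠ a := by rintro rfl; exact hm rfl
    have h2 : m ≠ letterInv a := by rintro rfl; exact hm rfl
    simp [h1, h2]

end WhiteheadMoves

/-! ### Finiteness and symmetry of the crossing number. -/

section CrossingNumbers

variable {α G : Type*} [DecidableEq α] [Group G]

/-- The half-spaces of `f`, labelled by directed edges, which cross `A`. -/
def crossingSet (f : FreeGroup α ≃* G) (A : Set G) : Set (G × (α × Bool)) :=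
  {p | Crosses A (p.1 • halfSpace f p.2)}

theorem crossingSet_compl (f : FreeGroup α ≃* G) (A : Set G) :
    crossingSet f Aᶜ = crossingSet f A := by
  ext p; exact crosses_compl_left_iff

theorem crossingSet_smul (f : FreeGroup α ≃* G) (A : Set G) (g : G) :
    crossingSet f (g • A) = (fun p => (g * p.1, p.2)) '' crossingSet f A := by
  ext ⟨h, l⟩
  simp only [crossingSet, Set.mem_ofPred_eq, Set.mem_image]
  constructor
  · intro hc
    refine ⟨(g⁻¹ * h, l), ?_, by simp⟩
    rw [← crosses_smul_iff g, ← mul_smul, mul_inv_cancel_left]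
    exact hc
  · rintro ⟨⟨h', l'⟩, hc, heq⟩
    obtain ⟨rfl, rfl⟩ := Prod.mk.inj heq
    rw [mul_smul, crosses_smul_iff]
    exact hc

theorem ncard_crossingSet_smul (f : FreeGroup α ≃* G) (A : Set G) (g : G) :
    (crossingSet f (g • A)).ncard = (crossingSet f A).ncard := by
  rw [crossingSet_smul, Set.ncard_image_of_injective]
  rintro ⟨a, b⟩ ⟨c, d⟩ h
  simpa using h

/-- Cutting `A` along `B` creates no new crossing. Up to complement, `C` lies in `B` or is disjoint
from it. A set disjoint from `B` cannot meet `A ∩ B`; for a subset of `B`, the corner outside both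
sets comes from the crossing of `A` with `B`. -/
theorem crosses_of_crosses_inter {A B C : Set G} (hAB : Crosses A B) (hBC : ¬ Crosses B C)
    (h : Crosses (A ∩ B) C) : Crosses A C := by
  have key : ∀ C : Set G, C ⊆ B → Crosses (A ∩ B) C → Crosses A C := by
    rintro C hC ⟨h1, h2, h3, h4⟩
    refine ⟨h1.mono (by gcongr; exact Set.inter_subset_left),
      h2.mono (by gcongr; exact Set.inter_subset_left), ?_, ?_⟩
    · obtain ⟨x, hx, hx'⟩ := h3
      exact ⟨x, fun hA => hx ⟨hA, hC hx'⟩, hx'⟩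
    · exact hAB.2.2.2.mono (by gcongr)
  rw [not_crosses_iff] at hBC
  rcases hBC with h' | h' | h' | h'
  · obtain ⟨x, hx, hx'⟩ := h.1
    exact absurd hx' (h' hx.2)
  · obtain ⟨x, hx, hx'⟩ := h.2.1
    exact absurd (h' hx.2) hx'
  · exact key C h' h
  · exact crosses_compl_right_iff.1 (key _ h' h.compl_right)

/-- A half-space is connected in the tree of `f`, and crossing makes membership in `A` nonconstant
on it, so membership must change along some edge starting in `B`. -/
theorem exists_mem_separated_of_crosses (f : FreeGroup α ≃* G) {A B : Set G}
    (hB : IsHalfSpace f B) (h : Crosses A B) : ∃ v ∈ B, ∃ l, v ∈ separated (f (letter l)) A := by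
  obtain ⟨g, m, rfl⟩ := hB
  by_contra! hcon
  have key : ∀ w : List (α × Bool), FreeGroup.IsReduced w → w.head? = some m →
      (g * f (FreeGroup.mk w) ∈ A ↔ g * f (letter m) ∈ A) := by
    intro w
    induction w using List.reverseRecOn with
    | nil => simp
    | append_singleton w l ih =>
      intro hr hm
      cases hw : w with
      | nil =>
        subst hw
        obtain rfl : l = m := by simpa using hm
        rfl
      | cons a t =>
        have ha : a = m := by simpa [hw] using hm
        have hr' : FreeGroup.IsReduced w := hr.infix (List.prefix_append w [l]).isInfix
        have h1 := ih hr' (by simp [hw, ha])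
        have h2 := hcon (g * f (FreeGroup.mk w)) (by
          rw [Set.mem_smul_set_iff_inv_smul_mem, smul_eq_mul, inv_mul_cancel_left]
          simp only [halfSpace, Set.mem_ofPred_eq, MulEquiv.symm_apply_apply,
            FreeGroup.toWord_mk, hr'.reduce_eq]
          simp [hw, ha]) l
        simp only [separated, Set.mem_ofPred_eq, not_not] at h2
        rw [← hw, ← h1, h2, mul_assoc, ← map_mul, mk_mul_letter]
  have key' : ∀ x ∈ g • halfSpace f m, (x ∈ A ↔ g * f (letter m) ∈ A) := by
    intro x hx
    rw [Set.mem_smul_set_iff_inv_smul_mem] at hx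
    have := key (f.symm (g⁻¹ * x)).toWord FreeGroup.isReduced_toWord hx
    rwa [FreeGroup.mk_toWord, MulEquiv.apply_symm_apply, mul_inv_cancel_left] at this
  obtain ⟨x, hx1, hx2⟩ := h.1
  obtain ⟨y, hy1, hy2⟩ := h.2.2.1
  exact hy1 ((key' y hy2).2 ((key' x hx2).1 hx1))

variable [Fintype α]

/-- Only finitely many edges of the tree of `f` are separated by `A`. A half-space crossing `A` has
an endpoint `v` of such an edge inside and another, `v'`, outside, so its boundary edge lies on the
finite path from `v'` to `v`. -/
theorem finite_crossingSet (f : FreeGroup α ≃* G) {A : Set G}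
    (hA : ∀ u, (separated u A).Finite) : (crossingSet f A).Finite := by
  set V := ⋃ l, separated (f (letter l)) A with hV
  have hVf : V.Finite := Set.finite_iUnion fun l => hA _
  refine Set.Finite.subset (s := ⋃ v ∈ V, ⋃ v' ∈ V, ⋃ m : α × Bool, (fun k => (v' * k⁻¹, m)) ''
    {k | k ∉ halfSpace f m ∧ k * (v'⁻¹ * v) ∈ halfSpace f m}) ?_ ?_
  · refine hVf.biUnion fun v _ => hVf.biUnion fun v' _ => Set.finite_iUnion fun m => ?_
    refine Set.Finite.image _ ?_
    rw [← Set.encard_lt_top_iff, encard_entering]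
    exact ENat.natCast_lt_top _
  · rintro ⟨g, m⟩ hgm
    have hgm' : Crosses A (g • halfSpace f m) := hgm
    have hhs : IsHalfSpace f (g • halfSpace f m) := (isHalfSpace_halfSpace f m).smul g
    obtain ⟨v, hv, l, hvl⟩ := exists_mem_separated_of_crosses f hhs hgm'
    obtain ⟨v', hv', l', hvl'⟩ := exists_mem_separated_of_crosses f hhs.compl hgm'.compl_right
    simp only [Set.mem_iUnion]
    refine ⟨v, Set.mem_iUnion.2 ⟨l, hvl⟩, v', Set.mem_iUnion.2 ⟨l', hvl'⟩, m, g⁻¹ * v', ?_, ?_⟩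
    · rw [Set.mem_compl_iff, Set.mem_smul_set_iff_inv_smul_mem] at hv'
      rw [Set.mem_smul_set_iff_inv_smul_mem] at hv
      refine ⟨hv', ?_⟩
      rwa [mul_assoc, mul_inv_cancel_left]
    · simp

theorem IsHalfSpace.finite_crossingSet {e : FreeGroup α ≃* G} {A : Set G} (h : IsHalfSpace e A)
    (f : FreeGroup α ≃* G) : (crossingSet f A).Finite :=
  _root_.finite_crossingSet f fun u => h.finite_separated u

/-- The number of orbits of pairs of crossing half-spaces. -/
noncomputable def crossingNumber (e f : FreeGroup α ≃* G) : ℕ :=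
  ∑ l, (crossingSet f (halfSpace e l)).ncard

theorem crossingNumber_eq_card (e f : FreeGroup α ≃* G) : crossingNumber e f =
    Nat.card (Σ l : α × Bool, crossingSet f (halfSpace e l)) := by
  have : ∀ l, Finite (crossingSet f (halfSpace e l)) := fun l =>
    ((isHalfSpace_halfSpace e l).finite_crossingSet f).to_subtype
  rw [Nat.card_sigma]
  rfl

/-- Translation by `g⁻¹` moves the other member of a crossing pair to the base point. -/
theorem crossingNumber_comm (e f : FreeGroup α ≃* G) :
    crossingNumber e f = crossingNumber f e := by
  have key : ∀ (e f : FreeGroup α ≃* G) (g : G) (l m : α × Bool),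
      Crosses (halfSpace e l) (g • halfSpace f m) →
      Crosses (halfSpace f m) (g⁻¹ • halfSpace e l) := by
    intro e f g l m h
    rw [← crosses_smul_iff g, smul_inv_smul]
    exact h.symm
  rw [crossingNumber_eq_card, crossingNumber_eq_card]
  refine Nat.card_congr
    { toFun := fun x => ⟨x.2.1.2, ⟨(x.2.1.1⁻¹, x.1), key _ _ _ _ _ x.2.2⟩⟩
      invFun := fun x => ⟨x.2.1.2, ⟨(x.2.1.1⁻¹, x.1), key _ _ _ _ _ x.2.2⟩⟩
      left_inv := fun x => by simp
      right_inv := fun x => by simp }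

end CrossingNumbers

/-! ### Cutting a half-space along an arm. -/

section Surgery

variable {α G : Type*} [DecidableEq α] [Group G]

/-- The weight of the part of the boundary of `B` which lies in `A`. -/
noncomputable def armWeight (u : G) (A B : Set G) : ℕ∞ :=
  (separated u B ∩ {g | g ∈ A ∧ g * u ∈ A}).encard

theorem armWeight_compl_right (u : G) (A B : Set G) : armWeight u A Bᶜ = armWeight u A B := by
  rw [armWeight, separated_compl, armWeight]

theorem armWeight_mono (u : G) {A A' : Set G} (B : Set G) (h : A ⊆ A') :
    armWeight u A B ≤ armWeight u A' B :=
  Set.encard_le_encard (Set.inter_subset_inter_right _ fun _ hg => ⟨h hg.1, h hg.2⟩)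

/-- Passing from `A` to `A ∩ B` discards the pairs cut by `A` inside `Bᶜ` and gains at most the
pairs cut by `B` inside `A`. The set `X` collects the pairs cut by `A` whose member in `A` also lies
in `B`; it enters both estimates. -/
theorem encard_separated_inter_le (u : G) {A B : Set G} (h : armWeight u A B ≤ armWeight u Bᶜ A) :
    (separated u (A ∩ B)).encard ≤ (separated u A).encard := by
  set X := separated u A ∩ {g | (g ∈ A → g ∈ B) ∧ (g * u ∈ A → g * u ∈ B)} with hX
  calc (separated u (A ∩ B)).encard
      ≤ (separated u B ∩ {g | g ∈ A ∧ g * u ∈ A} ∪ X).encard := by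
        apply Set.encard_le_encard
        intro g hg
        simp only [separated, Set.mem_ofPred_eq, Set.mem_inter_iff, Set.mem_union, hX] at hg ⊢
        tauto
    _ ≤ armWeight u A B + X.encard := Set.encard_union_le _ _
    _ ≤ armWeight u Bᶜ A + X.encard := by gcongr
    _ = (separated u A ∩ {g | g ∈ Bᶜ ∧ g * u ∈ Bᶜ} ∪ X).encard := by
        rw [Set.encard_union_eq]
        · rfl
        · rw [Set.disjoint_left]
          intro g hg hg'
          simp only [separated, Set.mem_ofPred_eq, Set.mem_inter_iff, Set.mem_compl_iff, hX]
            at hg hg'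
          tauto
    _ ≤ (separated u A).encard := by
        apply Set.encard_le_encard
        intro g hg
        rcases hg with hg | hg <;> exact hg.1

/-- If every direction at a vertex other than `l` lies on one side of `B`, then the part of `B`
beyond `l` is, up to complement, a union of half-spaces to which a Whitehead move applies. -/
theorem exists_letters_of_inter (e : FreeGroup α ≃* G) {l : α × Bool} {B : Set G}
    (hB : ∀ m, m ≠ l → halfSpace e m ⊆ B ∨ halfSpace e m ⊆ Bᶜ)
    (hl : halfSpace e (letterInv l) ⊆ B) :
    ∃ (P : Set (α × Bool)) (a : α × Bool), a ∈ P ∧ letterInv a ∉ P ∧ a.1 = l.1 ∧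
      (⋃ m ∈ P, halfSpace e m = (halfSpace e l)ᶜ ∩ B ∨
        ⋃ m ∈ P, halfSpace e m = ((halfSpace e l)ᶜ ∩ B)ᶜ) := by
  -- A union of half-spaces at the base point never contains `1`. So if `1 ∈ B`, the complement of
  -- the region is written as such a union, with multiplier `l`; otherwise the region itself is,
  -- with multiplier `letterInv l`.
  by_cases h1 : (1 : G) ∈ B
  · refine ⟨{m | m = l ∨ ¬ halfSpace e m ⊆ B}, l, Or.inl rfl, ?_, rfl, Or.inr ?_⟩
    · rintro (h | h)
      · exact letterInv_ne _ h
      · exact h hl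
    · ext x
      simp only [Set.mem_iUnion, exists_prop, Set.mem_ofPred_eq, Set.mem_compl_iff,
        Set.mem_inter_iff]
      constructor
      · rintro ⟨m, hm, hx⟩ ⟨hxl, hxB⟩
        rcases hm with rfl | hm
        · exact hxl hx
        · by_cases hml : m = l
          · exact hxl (hml ▸ hx)
          · exact ((hB m hml).resolve_left hm) hx hxB
      · intro hx
        by_cases hxl : x ∈ halfSpace e l
        · exact ⟨l, Or.inl rfl, hxl⟩
        · have hxB : x ∉ B := fun h => hx ⟨hxl, h⟩
          obtain ⟨m, hm⟩ := exists_mem_halfSpace e (g := x) (by rintro rfl; exact hxB h1)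
          exact ⟨m, Or.inr fun h => hxB (h hm), hm⟩
  · refine ⟨{m | m ≠ l ∧ halfSpace e m ⊆ B}, letterInv l, ⟨letterInv_ne l, hl⟩, ?_, rfl,
      Or.inl ?_⟩
    · rintro ⟨h, -⟩
      exact h (letterInv_letterInv l)
    · ext x
      simp only [Set.mem_iUnion, exists_prop, Set.mem_ofPred_eq, Set.mem_compl_iff,
        Set.mem_inter_iff]
      constructor
      · rintro ⟨m, ⟨hml, hm⟩, hx⟩
        exact ⟨fun h => hml (eq_of_mem_halfSpace hx h), hm hx⟩
      · rintro ⟨hxl, hxB⟩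
        obtain ⟨m, hm⟩ := exists_mem_halfSpace e (g := x) (by rintro rfl; exact h1 hxB)
        have hml : m ≠ l := by rintro rfl; exact hxl hm
        refine ⟨m, ⟨hml, (hB m hml).resolve_right fun h => h hm hxB⟩, hm⟩

variable (e : FreeGroup α ≃* G)

/-- A Whitehead move which does not increase the number of occurrences of the changed letter does
not increase any number of occurrences. -/
theorem exists_whitehead_move_le (u : G) {P : Set (α × Bool)} {a : α × Bool} (ha : a ∈ P)
    (ha' : letterInv a ∉ P)
    (hu : (separated u (⋃ m ∈ P, halfSpace e m)).encard ≤ (separated u (halfSpace e a)).encard) :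
    ∃ ω : FreeGroup α ≃* FreeGroup α, IsSmall ω ∧
      (∀ i, occurrences (ω.trans e) u i ≤ occurrences e u i) ∧
      halfSpace (ω.trans e) a = ⋃ m ∈ P, halfSpace e m ∧
      ∀ m : α × Bool, m.1 ≠ a.1 → ∃ g : G, halfSpace (ω.trans e) m = g • halfSpace e m := by
  obtain ⟨ω, hω, h1, h2⟩ := exists_whitehead_move e ha ha'
  refine ⟨ω, hω, fun i => ?_, h1, h2⟩
  by_cases hi : i = a.1
  · subst hi
    rw [← h1, encard_separated_halfSpace, encard_separated_halfSpace] at hu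
    exact_mod_cast hu
  · obtain ⟨g, hg⟩ := h2 (i, true) hi
    have h := encard_separated_halfSpace (ω.trans e) u (i, true)
    rw [hg, encard_separated_smul, encard_separated_halfSpace] at h
    exact le_of_eq (by exact_mod_cast h.symm)

variable [Fintype α] {e}

/-- Surgery along an innermost arm reduces the crossing number. -/
theorem exists_move_of_innermost {f : FreeGroup α ≃* G} (u : G) {A B : Set G}
    (hA : IsHalfSpace e A) (hB : IsHalfSpace f B) (hAB : Crosses A B)
    (hin : ∀ A', IsHalfSpace e A' → A' ⊂ A → ¬ Crosses A' B)
    (h1 : (separated u (A ∩ B)).encard ≤ (separated u A).encard)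
    (h2 : (separated u (A ∩ Bᶜ)).encard ≤ (separated u A).encard) :
    ∃ ω : FreeGroup α ≃* FreeGroup α, IsSmall ω ∧
      (∀ i, occurrences (ω.trans e) u i ≤ occurrences e u i) ∧
      crossingNumber (ω.trans e) f < crossingNumber e f := by
  -- After translation by `g⁻¹`, the set `A` consists of the base point and the half-spaces of all
  -- letters except `l`. These are properly contained in it, so by innermostness none of them
  -- crosses the translate of `B`.
  obtain ⟨g, l, hgl⟩ := hA.compl
  have hAl : g⁻¹ • A = (halfSpace e l)ᶜ := by
    rw [← compl_compl A, hgl, Set.smul_set_compl, inv_smul_smul]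
  have hsub : ∀ m, m ≠ l → halfSpace e m ⊆ (halfSpace e l)ᶜ := fun m hm =>
    Set.subset_compl_iff_disjoint_right.2 (disjoint_halfSpace e hm)
  have hssub : ∀ m, m ≠ l → g • halfSpace e m ⊂ A := by
    refine fun m hm => ⟨?_, fun hs => ?_⟩
    · rw [Set.smul_set_subset_iff_subset_inv_smul_set, hAl]
      exact hsub m hm
    · rw [Set.subset_smul_set_iff, hAl] at hs
      exact one_notMem_halfSpace e _ (hs (one_notMem_halfSpace e _))
  -- This half-space lies on one side of `B`. Replacing `B` by its complement exchanges the two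
  -- weight hypotheses, which is why both are assumed.
  wlog hl : halfSpace e (letterInv l) ⊆ g⁻¹ • B generalizing B
  · refine this hB.compl hAB.compl_right (fun A' h h' => ?_) h2 (by rwa [compl_compl]) ?_
    · rw [crosses_compl_right_iff]; exact hin A' h h'
    · by_contra hl'
      have hcr : Crosses A B := hAB
      rw [← crosses_smul_iff g⁻¹, hAl] at hcr
      have hnc : ¬ Crosses (halfSpace e (letterInv l)) (g⁻¹ • B) := by
        intro hc
        rw [← crosses_smul_iff g, smul_inv_smul] at hc
        exact hin _ ((isHalfSpace_halfSpace e _).smul g) (hssub _ (letterInv_ne l)) hc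
      rw [Set.smul_set_compl] at hl'
      rcases not_crosses_iff.1 hnc with h | h | h | h
      · exact hl' h
      · exact hl h
      · obtain ⟨x, hx, hx'⟩ := hcr.2.2.1
        exact hx (hsub _ (letterInv_ne l) (h hx'))
      · obtain ⟨x, hx, hx'⟩ := hcr.2.2.2
        exact hx (hsub _ (letterInv_ne l) (h hx'))
  have hcr : Crosses A B := hAB
  rw [← crosses_smul_iff g⁻¹, hAl] at hcr
  have hside : ∀ m, m ≠ l → halfSpace e m ⊆ g⁻¹ • B ∨ halfSpace e m ⊆ (g⁻¹ • B)ᶜ := by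
    intro m hm
    have hnc : ¬ Crosses (halfSpace e m) (g⁻¹ • B) := by
      intro hc
      rw [← crosses_smul_iff g, smul_inv_smul] at hc
      exact hin _ ((isHalfSpace_halfSpace e _).smul g) (hssub _ hm) hc
    rcases not_crosses_iff.1 hnc with h | h | h | h
    · exact Or.inr h
    · exact Or.inl h
    · obtain ⟨x, hx, hx'⟩ := hcr.2.2.1
      exact absurd (hsub _ hm (h hx')) hx
    · obtain ⟨x, hx, hx'⟩ := hcr.2.2.2
      exact absurd (hsub _ hm (h hx')) hx
  obtain ⟨P, a, ha, ha', hal, hD⟩ := exists_letters_of_inter e hside hl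
  have hAB' : (halfSpace e l)ᶜ ∩ g⁻¹ • B = g⁻¹ • (A ∩ B) := by
    rw [Set.smul_set_inter, hAl]
  have hDsep : (separated u (⋃ m ∈ P, halfSpace e m)).encard = (separated u (A ∩ B)).encard := by
    rcases hD with hD | hD
    · rw [hD, hAB', encard_separated_smul]
    · rw [hD, separated_compl, hAB', encard_separated_smul]
  have hAsep : (separated u A).encard = (separated u (halfSpace e a)).encard := by
    rw [encard_separated_halfSpace, hal, ← encard_separated_halfSpace, ← separated_compl,
      hgl, encard_separated_smul]
  have hDcr : (crossingSet f (⋃ m ∈ P, halfSpace e m)).ncard = (crossingSet f (A ∩ B)).ncard := by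
    rcases hD with hD | hD
    · rw [hD, hAB', ncard_crossingSet_smul]
    · rw [hD, crossingSet_compl, hAB', ncard_crossingSet_smul]
  have hAcr : (crossingSet f A).ncard = (crossingSet f (halfSpace e l)).ncard := by
    rw [← crossingSet_compl, hgl, ncard_crossingSet_smul]
  have hinv : ∀ (e : FreeGroup α ≃* G) (m m' : α × Bool), m.1 = m'.1 →
      (crossingSet f (halfSpace e m)).ncard = (crossingSet f (halfSpace e m')).ncard := by
    intro e m m' h
    rcases eq_or_eq_letterInv h with rfl | rfl
    · rfl
    · rw [← crossingSet_compl f (halfSpace e m'), ← letter_smul_halfSpace, ncard_crossingSet_smul]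
  -- No crossing is created, and the crossing with `B` itself disappears because `A ∩ B ⊆ B`.
  have hlt : (crossingSet f (A ∩ B)).ncard < (crossingSet f A).ncard := by
    refine Set.ncard_lt_ncard ⟨fun p hp => ?_, fun hs => ?_⟩ (hA.finite_crossingSet f)
    · exact crosses_of_crosses_inter hAB
        (not_crosses_of_isHalfSpace hB ((isHalfSpace_halfSpace f p.2).smul p.1)) hp
    · obtain ⟨h, m, rfl⟩ := hB
      obtain ⟨x, hx, hx'⟩ := (hs (show (h, m) ∈ crossingSet f A from hAB)).2.1
      exact hx' hx.2
  obtain ⟨ω, hω, hocc, hωa, hωm⟩ := exists_whitehead_move_le e u ha ha'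
    (by rw [hDsep, ← hAsep]; exact h1)
  have hle : ∀ m, m.1 = a.1 → (crossingSet f (halfSpace (ω.trans e) m)).ncard <
      (crossingSet f (halfSpace e m)).ncard := by
    intro m hm
    rw [hinv _ m a hm, hωa, hDcr, hinv e m l (hm.trans hal), ← hAcr]
    exact hlt
  refine ⟨ω, hω, hocc, Finset.sum_lt_sum (fun m _ => ?_) ⟨a, Finset.mem_univ _, hle a rfl⟩⟩
  by_cases hm : m.1 = a.1
  · exact (hle m hm).le
  · obtain ⟨x, hx⟩ := hωm m hm
    rw [hx, ncard_crossingSet_smul]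

end Surgery

/-! ### Reducing the crossing number of two bases. -/

section CrossingCase

variable {α G : Type*} [DecidableEq α] [Group G] [Fintype α]

/-- Shrinking `A` to an innermost half-space that crosses `B` can only make the arm lighter. The
hypothesis, used for both `B` and its complement, then gives the weight comparison needed on either
side of the cut. -/
theorem exists_move_of_armWeight_le {e f : FreeGroup α ≃* G} (u : G) {A B : Set G}
    (hA : IsHalfSpace e A) (hB : IsHalfSpace f B) (hAB : Crosses A B)
    (hmin : ∀ A' B', IsHalfSpace e A' → IsHalfSpace f B' → Crosses A' B' →
      armWeight u A B ≤ armWeight u B' A') :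
    ∃ ω : FreeGroup α ≃* FreeGroup α, IsSmall ω ∧
      (∀ i, occurrences (ω.trans e) u i ≤ occurrences e u i) ∧
      crossingNumber (ω.trans e) f < crossingNumber e f := by
  set S : Set (Set G) := {A' | IsHalfSpace e A' ∧ Crosses A' B} with hS
  have hfin : S.Finite := by
    refine ((hB.finite_crossingSet e).image fun p => p.1 • halfSpace e p.2).subset ?_
    rintro _ ⟨⟨g, l, rfl⟩, hc⟩
    exact ⟨(g, l), hc.symm, rfl⟩
  obtain ⟨A', hA'A, hA'⟩ := hfin.exists_le_minimal (show A ∈ S from ⟨hA, hAB⟩)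
  have hle : ∀ B', IsHalfSpace f B' → Crosses A' B' →
      armWeight u A' B ≤ armWeight u B' A' := fun B' hB' hc =>
    (armWeight_mono u B hA'A).trans (hmin A' B' hA'.1.1 hB' hc)
  refine exists_move_of_innermost u hA'.1.1 hB hA'.1.2 (fun A'' h h' hc => ?_) ?_ ?_
  · exact h'.2 (hA'.2 ⟨h, hc⟩ h'.1)
  · exact encard_separated_inter_le u (hle _ hB.compl hA'.1.2.compl_right)
  · refine encard_separated_inter_le u ?_
    rw [armWeight_compl_right, compl_compl]
    exact hle _ hB hA'.1.2

/-- Take an arm of least weight among those of both bases. The basis to be changed is the one whose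
half-space contains the arm. -/
theorem exists_move_of_crosses {e f : FreeGroup α ≃* G} (u : G) {A B : Set G}
    (hA : IsHalfSpace e A) (hB : IsHalfSpace f B) (hAB : Crosses A B) :
    (∃ ω : FreeGroup α ≃* FreeGroup α, IsSmall ω ∧
      (∀ i, occurrences (ω.trans e) u i ≤ occurrences e u i) ∧
      crossingNumber (ω.trans e) f < crossingNumber e f) ∨
    (∃ ω : FreeGroup α ≃* FreeGroup α, IsSmall ω ∧
      (∀ i, occurrences (ω.trans f) u i ≤ occurrences f u i) ∧
      crossingNumber (ω.trans f) e < crossingNumber f e) := by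
  set S : Set ℕ∞ := {x | ∃ A B, IsHalfSpace e A ∧ IsHalfSpace f B ∧ Crosses A B ∧
    (x = armWeight u A B ∨ x = armWeight u B A)}
  obtain ⟨x, ⟨A', B', hA', hB', hc, hx⟩, hmin⟩ := WellFounded.has_min wellFounded_lt S
    ⟨_, A, B, hA, hB, hAB, Or.inl rfl⟩
  rcases hx with rfl | rfl
  · left
    refine exists_move_of_armWeight_le u hA' hB' hc fun A'' B'' h1 h2 h3 => not_lt.1 ?_
    exact hmin _ ⟨A'', B'', h1, h2, h3, Or.inr rfl⟩
  · right
    refine exists_move_of_armWeight_le u hB' hA' hc.symm fun B'' A'' h1 h2 h3 => not_lt.1 ?_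
    exact hmin _ ⟨A'', B'', h2, h1, h3.symm, Or.inl rfl⟩

end CrossingCase

/-! ### Exchanging half-spaces when nothing crosses. -/

section NestedCase

variable {α G : Type*} [DecidableEq α] [Group G]

theorem eq_of_letter_mem_smul {f : FreeGroup α ≃* G} {g : G} {l k : α × Bool}
    (h1 : (1 : G) ∉ g • halfSpace f l) (hk : f (letter k) ∈ g • halfSpace f l) :
    g = 1 ∧ l = k := by
  rw [smul_halfSpace_eq_cylinder f h1] at hk
  simp only [cylinder, Set.mem_ofPred_eq, MulEquiv.symm_apply_apply, toWord_letter] at hk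
  have hlen := hk.length_le
  simp only [List.length_append, List.length_cons, List.length_nil] at hlen
  have hw : (f.symm g).toWord = [] := List.length_eq_zero_iff.1 (by omega)
  refine ⟨by simpa using hw, ?_⟩
  rw [hw] at hk
  simpa using hk

/-- A half-space contained in another one and containing the endpoint of its boundary edge. -/
theorem eq_of_subset_of_endpoint_mem {f : FreeGroup α ≃* G} {C : Set G} (hC : IsHalfSpace f C)
    {g : G} {k : α × Bool} (hsub : C ⊆ g • halfSpace f k) (hz : g * f (letter k) ∈ C) :
    C = g • halfSpace f k := by
  have h := hC.smul g⁻¹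
  obtain ⟨x, l, hx⟩ := h
  have h1 : (1 : G) ∉ x • halfSpace f l := by
    rw [← hx, Set.mem_smul_set_iff_inv_smul_mem]
    intro h
    have := hsub h
    rw [Set.mem_smul_set_iff_inv_smul_mem] at this
    simp [one_notMem_halfSpace] at this
  have h2 : f (letter k) ∈ x • halfSpace f l := by
    rw [← hx, Set.mem_smul_set_iff_inv_smul_mem]
    simpa using hz
  obtain ⟨rfl, rfl⟩ := eq_of_letter_mem_smul h1 h2
  rw [one_smul, inv_smul_eq_iff] at hx
  exact hx

/-- A set which crosses no half-space of the basis `e` is, up to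
translation and complement, a union of half-spaces at the base point. -/
theorem exists_eq_iUnion_halfSpace {e : FreeGroup α ≃* G} {B : Set G}
    (hnc : ∀ A, IsHalfSpace e A → ¬ Crosses A B) (hne : B.Nonempty)
    (hne' : Bᶜ.Nonempty) :
    ∃ (g : G) (P : Set (α × Bool)), ⋃ m ∈ P, halfSpace e m = g • B ∨
      ⋃ m ∈ P, halfSpace e m = g • Bᶜ := by
  have hstep : ∃ x l, x ∉ B ∧ x * e (letter l) ∈ B := by
    by_contra! hcon
    obtain ⟨x, hx⟩ := hne'
    obtain ⟨y, hy⟩ := hne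
    have : ∀ w : List (α × Bool), x * e (FreeGroup.mk w) ∉ B := by
      intro w
      induction w using List.reverseRecOn with
      | nil => simpa [← FreeGroup.one_eq_mk] using hx
      | append_singleton w l ih =>
        rw [← mk_mul_letter, map_mul, ← mul_assoc]
        exact hcon _ _ ih
    apply this (e.symm (x⁻¹ * y)).toWord
    rwa [FreeGroup.mk_toWord, MulEquiv.apply_symm_apply, mul_inv_cancel_left]
  -- the case in which the boundary edge of a half-space inside the set starts at the base point
  have key : ∀ (C : Set G) (l : α × Bool), (∀ A, IsHalfSpace e A → ¬ Crosses A C) →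
      (1 : G) ∉ C → e (letter l) ∈ C → halfSpace e l ⊆ C →
      ∃ P : Set (α × Bool), ⋃ m ∈ P, halfSpace e m = C := by
    intro C l hC h1 hl hlC
    have hside : ∀ m, halfSpace e m ⊆ C ∨ halfSpace e m ⊆ Cᶜ := by
      intro m
      by_cases hml : m = l
      · exact Or.inl (hml ▸ hlC)
      rcases not_crosses_iff.1 (hC _ (isHalfSpace_halfSpace e m)) with h | h | h | h
      · exact Or.inr h
      · exact Or.inl h
      · exact absurd (eq_of_mem_halfSpace (letter_mem_halfSpace e l) (h hl)) (Ne.symm hml)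
      · exact absurd (h h1) (one_notMem_halfSpace e m)
    refine ⟨{m | halfSpace e m ⊆ C}, ?_⟩
    ext x
    simp only [Set.mem_iUnion, exists_prop, Set.mem_ofPred_eq]
    constructor
    · rintro ⟨m, hm, hx⟩
      exact hm hx
    · intro hx
      obtain ⟨m, hm⟩ := exists_mem_halfSpace e (g := x) (by rintro rfl; exact h1 hx)
      exact ⟨m, (hside m).resolve_right fun h => h hm hx, hm⟩
  obtain ⟨x, l, hx, hxl⟩ := hstep
  have h1 : (1 : G) ∉ x⁻¹ • B := by
    rw [Set.mem_smul_set_iff_inv_smul_mem]; simpa using hx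
  have hl : e (letter l) ∈ x⁻¹ • B := by
    rw [Set.mem_smul_set_iff_inv_smul_mem]; simpa using hxl
  have hnc' : ∀ (g : G) (A : Set G), IsHalfSpace e A → ¬ Crosses A (g • B) := by
    intro g A hA hc
    rw [← crosses_smul_iff g⁻¹, inv_smul_smul] at hc
    exact hnc _ (hA.smul _) hc
  rcases not_crosses_iff.1 (hnc' x⁻¹ _ (isHalfSpace_halfSpace e l)) with h | h | h | h
  · exact absurd hl (h (letter_mem_halfSpace e l))
  · obtain ⟨P, hP⟩ := key _ l (hnc' _) h1 hl h
    exact ⟨_, P, Or.inl hP⟩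
  -- Here the edge found above points the wrong way: seen from its other end, the complement of the
  -- set contains a half-space at the base point, and `key` applies to the complement.
  · set y := (e (letter l))⁻¹ * x⁻¹ with hy
    have hC : y • Bᶜ = (y • B)ᶜ := Set.smul_set_compl
    have h1' : (1 : G) ∉ y • Bᶜ := by
      rw [hC, Set.notMem_compl_iff, hy, mul_smul, Set.mem_smul_set_iff_inv_smul_mem]
      simpa using hl
    have hl' : e (letter (letterInv l)) ∈ y • Bᶜ := by
      rw [hC, Set.mem_compl_iff, hy, mul_smul, Set.mem_smul_set_iff_inv_smul_mem,
        letter_letterInv]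
      simpa using h1
    have hsub : halfSpace e (letterInv l) ⊆ y • Bᶜ := by
      have h' := letter_smul_halfSpace e (letterInv l)
      rw [letterInv_letterInv, letter_letterInv, map_inv] at h'
      rw [hC, Set.subset_compl_comm, ← h', hy, mul_smul]
      exact Set.smul_set_mono h
    obtain ⟨P, hP⟩ := key _ (letterInv l)
      (fun A hA => by rw [hC, crosses_compl_right_iff]; exact hnc' y A hA) h1' hl' hsub
    exact ⟨_, P, Or.inr hP⟩
  · exact absurd (h h1) (one_notMem_halfSpace e l)

/-- A common refinement of two bases: a half-space of `f` can be exchanged for one of `e`. -/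
theorem exists_letter_of_eq_iUnion {e f : FreeGroup α ≃* G} {B : Set G} (hf : IsHalfSpace f B)
    (he : ¬ IsHalfSpace e B) {P : Set (α × Bool)} (hP : ⋃ m ∈ P, halfSpace e m = B) :
    ∃ a ∈ P, letterInv a ∉ P ∧ ¬ IsHalfSpace f (halfSpace e a) := by
  by_contra! hcon
  obtain ⟨g, k, hgk⟩ := hf
  -- The endpoint inside `B` of its boundary edge in the tree of `f`: no smaller half-space of `f`
  -- inside `B` contains it.
  set z := g * f (letter k) with hz
  have hzB : z ∈ B := by
    rw [hgk, Set.mem_smul_set_iff_inv_smul_mem, hz, smul_eq_mul, inv_mul_cancel_left]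
    exact letter_mem_halfSpace f k
  have hmax : ∀ C, IsHalfSpace f C → C ⊆ B → z ∈ C → C = B := by
    intro C hC hCB hzC
    rw [hgk] at hCB ⊢
    exact eq_of_subset_of_endpoint_mem hC hCB hzC
  have hmem : ∀ {x a}, x ∈ B → x ∈ halfSpace e a → a ∈ P := by
    intro x a hx ha
    rw [← hP] at hx
    simp only [Set.mem_iUnion, exists_prop] at hx
    obtain ⟨m, hm, hxm⟩ := hx
    rwa [eq_of_mem_halfSpace ha hxm]
  have hsubB : ∀ {a}, a ∈ P → halfSpace e a ⊆ B := fun ha =>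
    hP ▸ Set.subset_biUnion_of_mem (u := fun m => halfSpace e m) ha
  have h1B : (1 : G) ∉ B := by
    rw [← hP]; simp [one_notMem_halfSpace]
  -- Walk from `1` to `z` in the tree of `e`. At each step the next letter `a` lies in `P`, and so
  -- does its inverse, since otherwise `x • halfSpace e a` would be a half-space of `f` inside `B`
  -- containing `z`, hence `B`. If the next translate missed `z`, its complement would equal `B` for
  -- the same reason, again making `B` a half-space of `e`. At the end of the walk this puts `1` in
  -- `B`, which is absurd.
  have key : ∀ p : List (α × Bool), p <+: (e.symm z).toWord → z ∈ e (FreeGroup.mk p) • B := by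
    intro p
    induction p using List.reverseRecOn with
    | nil => intro _; simpa [← FreeGroup.one_eq_mk] using hzB
    | append_singleton p a ih =>
      intro hp
      set x := e (FreeGroup.mk p) with hx
      have hzx := ih ((List.prefix_append p [a]).trans hp)
      have hpr : FreeGroup.IsReduced p := (FreeGroup.isReduced_toWord (x := e.symm z)).infix
        ((List.prefix_append p [a]).trans hp).isInfix
      have hpw : (FreeGroup.mk p).toWord = p := by rw [FreeGroup.toWord_mk, hpr.reduce_eq]
      have hza : x⁻¹ * z ∈ halfSpace e a ∧ x⁻¹ ∉ halfSpace e a := by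
        have := prefix_toWord_iff (FreeGroup.mk p) (e.symm z) a
        rw [hpw] at this
        have := this.2 hp
        rw [hx]
        simp only [halfSpace, Set.mem_ofPred_eq, map_mul, map_inv, MulEquiv.symm_apply_apply]
        exact ⟨this.2, this.1⟩
      rw [Set.mem_smul_set_iff_inv_smul_mem, smul_eq_mul] at hzx
      have haP : a ∈ P := hmem hzx hza.1
      have hz1 : z ∈ x • halfSpace e a := by
        rw [Set.mem_smul_set_iff_inv_smul_mem]; exact hza.1
      have hxB : x • halfSpace e a ⊆ B := by
        have h1 : (1 : G) ∉ x • halfSpace e a := by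
          rw [Set.mem_smul_set_iff_inv_smul_mem, smul_eq_mul, mul_one]; exact hza.2
        obtain ⟨m, hm⟩ := subset_halfSpace_of_one_notMem e
          ((isHalfSpace_halfSpace e a).smul x) h1
        exact hm.trans (hsubB (hmem hzB (hm hz1)))
      have hneB : x • halfSpace e a ≠ B := fun h =>
        he (h ▸ (isHalfSpace_halfSpace e a).smul x)
      have hia : letterInv a ∈ P := by
        by_contra hia
        exact hneB (hmax _ ((hcon a haP hia).smul x) hxB hz1)
      rw [← mk_mul_letter, map_mul, ← hx]
      by_contra hzn
      have hsub : (x * e (letter a)) • Bᶜ ⊆ x • halfSpace e a := by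
        rw [Set.smul_set_compl, Set.compl_subset_comm, compl_smul_halfSpace]
        exact Set.smul_set_mono (hsubB hia)
      have heq : (x * e (letter a)) • Bᶜ = B := by
        refine hmax _ (IsHalfSpace.smul ?_ _) (hsub.trans hxB) ?_
        · exact IsHalfSpace.compl ⟨g, k, hgk⟩
        · rw [Set.smul_set_compl]; exact hzn
      exact hneB (hxB.antisymm (heq ▸ hsub))
  have := key _ (List.prefix_refl _)
  rw [FreeGroup.mk_toWord, MulEquiv.apply_symm_apply, Set.mem_smul_set_iff_inv_smul_mem] at this
  simp [h1B] at this

/-- Two bases with the same half-spaces agree up to order and inversion. -/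
theorem exists_letter_eq_of_isHalfSpace {e f : FreeGroup α ≃* G}
    (hef : ∀ l, IsHalfSpace f (halfSpace e l)) (hfe : ∀ l, IsHalfSpace e (halfSpace f l))
    (l : α × Bool) : ∃ m, e (letter l) = f (letter m) := by
  -- The half-spaces at the base point are the maximal ones that avoid `1`, so they depend only on
  -- the family of all half-spaces.
  have key : ∀ l, ∃ m, halfSpace e l = halfSpace f m := by
    intro l
    obtain ⟨m, hm⟩ := subset_halfSpace_of_one_notMem f (hef l) (one_notMem_halfSpace e l)
    obtain ⟨l', hl'⟩ := subset_halfSpace_of_one_notMem e (hfe m) (one_notMem_halfSpace f m)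
    have h := letter_mem_halfSpace e l
    obtain rfl := eq_of_mem_halfSpace h (hl' (hm h))
    exact ⟨m, hm.antisymm hl'⟩
  obtain ⟨m, hm⟩ := key l
  obtain ⟨m', hm'⟩ := key (letterInv l)
  have h := letter_smul_halfSpace e l
  rw [hm, ← letter_smul_halfSpace f m, hm', ← inv_smul_eq_iff, ← mul_smul] at h
  have h1 := (eq_of_letter_mem_smul (k := letterInv m) (by rw [h]; exact one_notMem_halfSpace f _)
    (by rw [h]; exact letter_mem_halfSpace f _)).1
  exact ⟨m, (inv_mul_eq_one.1 h1).symm⟩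

variable [Fintype α]

open Classical in
/-- The number of letters whose half-space for one of the bases is none for the other. -/
noncomputable def unsharedNumber (e f : FreeGroup α ≃* G) : ℕ :=
  (Finset.univ.filter fun l => ¬ IsHalfSpace f (halfSpace e l)).card +
    (Finset.univ.filter fun l => ¬ IsHalfSpace e (halfSpace f l)).card

theorem unsharedNumber_comm (e f : FreeGroup α ≃* G) :
    unsharedNumber e f = unsharedNumber f e := add_comm _ _

/-- Without crossings, a translate of `B` or of its complement is a union of half-spaces of `e` at
the base point, and the exchange lemma supplies an unshared letter `a` that it can replace. By
`hmin` the replacement is no heavier. Each half-space of the new basis is a translate of an old one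
or a half-space of `f`, so still nothing crosses. -/
theorem exists_move_of_nested {e f : FreeGroup α ≃* G} (u : G)
    (hnc : ∀ A B, IsHalfSpace e A → IsHalfSpace f B → ¬ Crosses A B) {B : Set G}
    (hf : IsHalfSpace f B) (he : ¬ IsHalfSpace e B)
    (hmin : ∀ A, IsHalfSpace e A → ¬ IsHalfSpace f A →
      (separated u B).encard ≤ (separated u A).encard) :
    ∃ ω : FreeGroup α ≃* FreeGroup α, IsSmall ω ∧
      (∀ i, occurrences (ω.trans e) u i ≤ occurrences e u i) ∧
      (∀ A B, IsHalfSpace (ω.trans e) A → IsHalfSpace f B → ¬ Crosses A B) ∧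
      unsharedNumber (ω.trans e) f < unsharedNumber e f := by
  have hne : ∀ {B : Set G}, IsHalfSpace f B → B.Nonempty := by
    rintro _ ⟨g, k, rfl⟩
    exact Set.Nonempty.smul_set ⟨_, letter_mem_halfSpace f k⟩
  obtain ⟨g, P, hgP⟩ := exists_eq_iUnion_halfSpace (fun A hA => hnc A B hA hf) (hne hf)
    (hne hf.compl)
  have hDf : IsHalfSpace f (⋃ m ∈ P, halfSpace e m) := by
    rcases hgP with h | h <;> rw [h]
    · exact hf.smul g
    · exact hf.compl.smul g
  have hDe : ¬ IsHalfSpace e (⋃ m ∈ P, halfSpace e m) := by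
    rcases hgP with h | h <;> rw [h, isHalfSpace_smul_iff]
    · exact he
    · rwa [isHalfSpace_compl_iff]
  have hDu : (separated u (⋃ m ∈ P, halfSpace e m)).encard = (separated u B).encard := by
    rcases hgP with h | h <;> rw [h, encard_separated_smul]
    rw [separated_compl]
  obtain ⟨a, ha, ha', haf⟩ := exists_letter_of_eq_iUnion hDf hDe rfl
  obtain ⟨ω, hω, hocc, hωa, hωm⟩ := exists_whitehead_move_le e u ha ha'
    (by rw [hDu]; exact hmin _ (isHalfSpace_halfSpace e a) haf)
  have hfst : ∀ m : α × Bool, m.1 = a.1 → IsHalfSpace f (halfSpace (ω.trans e) m) ∧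
      ¬ IsHalfSpace f (halfSpace e m) := by
    intro m hm
    rcases eq_or_eq_letterInv hm with rfl | rfl
    · exact ⟨hωa ▸ hDf, haf⟩
    · constructor
      · rw [← isHalfSpace_smul_iff ((ω.trans e) (letter a)), letter_smul_halfSpace, hωa]
        exact hDf.compl
      · rw [← isHalfSpace_smul_iff (e (letter a)), letter_smul_halfSpace, isHalfSpace_compl_iff]
        exact haf
  refine ⟨ω, hω, hocc, ?_, ?_⟩
  · rintro _ C ⟨x, m, rfl⟩ hC
    by_cases hm : m.1 = a.1
    · exact not_crosses_of_isHalfSpace ((hfst m hm).1.smul x) hC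
    · obtain ⟨y, hy⟩ := hωm m hm
      rw [hy]
      exact hnc _ _ (((isHalfSpace_halfSpace e m).smul y).smul x) hC
  · refine add_lt_add_of_lt_of_le (Finset.card_lt_card ?_) (Finset.card_le_card ?_)
    · rw [Finset.ssubset_iff_of_subset]
      · exact ⟨a, by simpa using haf, by simpa using (hfst a rfl).1⟩
      · intro m hm
        simp only [Finset.mem_filter, Finset.mem_univ, true_and] at hm ⊢
        by_cases hma : m.1 = a.1
        · exact (hfst m hma).2
        · obtain ⟨y, hy⟩ := hωm m hma
          rwa [hy, isHalfSpace_smul_iff] at hm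
    · intro m hm
      simp only [Finset.mem_filter, Finset.mem_univ, true_and] at hm ⊢
      rintro ⟨x, k, hx⟩
      by_cases hka : k.1 = a.1
      · apply (hfst k hka).2
        rw [← isHalfSpace_smul_iff x, ← hx]
        exact isHalfSpace_halfSpace f m
      · obtain ⟨y, hy⟩ := hωm k hka
        apply hm
        rw [hx, ← isHalfSpace_smul_iff x⁻¹, inv_smul_smul, ← isHalfSpace_smul_iff y, ← hy]
        exact isHalfSpace_halfSpace _ k

end NestedCase

/-! ### Common descent of two bases. -/

section PeakReduction

variable {α G : Type*} [DecidableEq α] [Group G] [Fintype α]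

/-- `e'` is obtained from the basis `e` by small automorphisms, none of which increases the number
of occurrences of any generator in the word of `u`. -/
def Descends (u : G) : (FreeGroup α ≃* G) → (FreeGroup α ≃* G) → Prop :=
  Relation.ReflTransGen fun e e' =>
    (∃ ω : FreeGroup α ≃* FreeGroup α, IsSmall ω ∧ e' = ω.trans e) ∧
      ∀ i, occurrences e' u i ≤ occurrences e u i

/-- A lightest unshared half-space, from whichever basis, is moved into the other basis. When no
unshared one remains, the bases agree up to order and inversion. -/
theorem exists_common_descent_of_nested (u : G) (e f : FreeGroup α ≃* G)
    (hnc : ∀ A B, IsHalfSpace e A → IsHalfSpace f B → ¬ Crosses A B) :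
    ∃ e' f' : FreeGroup α ≃* G, Descends u e e' ∧ Descends u f f' ∧
      ∀ l, ∃ m, e' (letter l) = f' (letter m) := by
  induction hN : unsharedNumber e f using Nat.strong_induction_on generalizing e f with
  | _ N ih =>
  subst hN
  set S : Set ℕ∞ := {x | ∃ A, x = (separated u A).encard ∧
    (IsHalfSpace e A ∧ ¬ IsHalfSpace f A ∨ IsHalfSpace f A ∧ ¬ IsHalfSpace e A)} with hS
  by_cases hne : S.Nonempty
  · obtain ⟨x, ⟨A, rfl, hA⟩, hmin⟩ := WellFounded.has_min wellFounded_lt S hne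
    rcases hA with ⟨hA, hA'⟩ | ⟨hA, hA'⟩
    · obtain ⟨ω, hω, hocc, hnc', hlt⟩ := exists_move_of_nested u
        (fun A B h h' hc => hnc B A h' h hc.symm) hA hA'
        fun B h h' => not_lt.1 (hmin _ ⟨B, rfl, Or.inr ⟨h, h'⟩⟩)
      rw [unsharedNumber_comm, unsharedNumber_comm f] at hlt
      obtain ⟨e', f', he, hf, hl⟩ := ih _ hlt e (ω.trans f)
        (fun A B h h' hc => hnc' B A h' h hc.symm) rfl
      exact ⟨e', f', he, Relation.ReflTransGen.head ⟨⟨ω, hω, rfl⟩, hocc⟩ hf, hl⟩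
    · obtain ⟨ω, hω, hocc, hnc', hlt⟩ := exists_move_of_nested u hnc hA hA'
        fun B h h' => not_lt.1 (hmin _ ⟨B, rfl, Or.inl ⟨h, h'⟩⟩)
      obtain ⟨e', f', he, hf, hl⟩ := ih _ hlt (ω.trans e) f hnc' rfl
      exact ⟨e', f', Relation.ReflTransGen.head ⟨⟨ω, hω, rfl⟩, hocc⟩ he, hf, hl⟩
  · refine ⟨e, f, .refl, .refl, exists_letter_eq_of_isHalfSpace (fun l => ?_) fun l => ?_⟩
    · by_contra h
      exact hne ⟨_, _, rfl, Or.inl ⟨isHalfSpace_halfSpace e l, h⟩⟩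
    · by_contra h
      exact hne ⟨_, _, rfl, Or.inr ⟨isHalfSpace_halfSpace f l, h⟩⟩

/-- **Peak reduction**: any two bases can be connected through bases for which no generator occurs
more often in the word of `u` than it does for the nearer end. -/
theorem exists_common_descent (u : G) (e f : FreeGroup α ≃* G) :
    ∃ e' f' : FreeGroup α ≃* G, Descends u e e' ∧ Descends u f f' ∧
      ∀ l, ∃ m, e' (letter l) = f' (letter m) := by
  induction hN : crossingNumber e f using Nat.strong_induction_on generalizing e f with
  | _ N ih =>
  subst hN
  by_cases hc : ∃ A B, IsHalfSpace e A ∧ IsHalfSpace f B ∧ Crosses A B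
  · obtain ⟨A, B, hA, hB, hAB⟩ := hc
    rcases exists_move_of_crosses u hA hB hAB with ⟨ω, hω, hocc, hlt⟩ | ⟨ω, hω, hocc, hlt⟩
    · obtain ⟨e', f', he, hf, hl⟩ := ih _ hlt (ω.trans e) f rfl
      exact ⟨e', f', Relation.ReflTransGen.head ⟨⟨ω, hω, rfl⟩, hocc⟩ he, hf, hl⟩
    · rw [crossingNumber_comm, crossingNumber_comm f] at hlt
      obtain ⟨e', f', he, hf, hl⟩ := ih _ hlt e (ω.trans f) rfl
      exact ⟨e', f', he, Relation.ReflTransGen.head ⟨⟨ω, hω, rfl⟩, hocc⟩ hf, hl⟩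
  · push Not at hc
    exact exists_common_descent_of_nested u e f hc

end PeakReduction

/-! ### Orbits of elements under automorphisms. -/

section Whitehead

variable {α : Type*} [DecidableEq α]

/-- Two elements of norm at most `N` which differ by a small automorphism. -/
def IsLink (N : ℕ) (x y : FreeGroup α) : Prop :=
  x.norm ≤ N ∧ y.norm ≤ N ∧ ∃ ω : FreeGroup α ≃* FreeGroup α, IsSmall ω ∧ ω x = y

theorem IsLink.symm {N : ℕ} {x y : FreeGroup α} (h : IsLink N x y) : IsLink N y x := by
  obtain ⟨h1, h2, ω, hω, rfl⟩ := h
  exact ⟨h2, h1, ω.symm, hω.symm, by simp⟩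

theorem norm_letter (l : α × Bool) : (letter l).norm = 1 := by
  simp [FreeGroup.norm, toWord_letter]

theorem norm_map_le_of_letter {ω : FreeGroup α →* FreeGroup α}
    (h : ∀ l, (ω (letter l)).norm ≤ 1) (x : FreeGroup α) : (ω x).norm ≤ x.norm := by
  have key : ∀ L : List (α × Bool), (ω (FreeGroup.mk L)).norm ≤ L.length := by
    intro L
    induction L with
    | nil => simp [← FreeGroup.one_eq_mk]
    | cons a L ih =>
      rw [← letter_mul_mk, map_mul, List.length_cons, add_comm]
      exact (FreeGroup.norm_mul_le _ _).trans (add_le_add (h a) ih)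
  have := key x.toWord
  rwa [FreeGroup.mk_toWord] at this

theorem letter_injective : Function.Injective (letter : α × Bool → FreeGroup α) := by
  intro l m h
  have := congrArg FreeGroup.toWord h
  simpa [toWord_letter] using this

theorem Descends.occurrences_le {G : Type*} [Group G] {u : G} {e e' : FreeGroup α ≃* G}
    (h : Descends u e e') (i : α) : occurrences e' u i ≤ occurrences e u i := by
  induction h with
  | refl => exact le_rfl
  | tail _ h ih => exact (h.2 i).trans ih

variable [Fintype α]

theorem Descends.norm_le {G : Type*} [Group G] {u : G} {e e' : FreeGroup α ≃* G}
    (h : Descends u e e') : (e'.symm u).norm ≤ (e.symm u).norm := by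
  rw [norm_eq_sum_occurrences, norm_eq_sum_occurrences]
  exact Finset.sum_le_sum fun i _ => h.occurrences_le i

theorem Descends.links {G : Type*} [Group G] {u : G} {e e' : FreeGroup α ≃* G}
    (h : Descends u e e') {N : ℕ} (hN : (e.symm u).norm ≤ N) :
    Relation.ReflTransGen (IsLink N) (e.symm u) (e'.symm u) := by
  induction h with
  | refl => exact .refl
  | @tail f f' hf h ih =>
    refine ih.tail ⟨(Descends.norm_le hf).trans hN, (Descends.norm_le (hf.tail h)).trans hN, ?_⟩
    obtain ⟨⟨ω, hω, rfl⟩, -⟩ := h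
    exact ⟨ω.symm, hω.symm, by simp⟩

/-- The change of basis permutes the letters, so it is small and does not increase norms. -/
theorem isLink_of_letter_eq {G : Type*} [Group G] {u : G} {e f : FreeGroup α ≃* G}
    (h : ∀ l, ∃ m, e (letter l) = f (letter m)) {N : ℕ} (hN : (e.symm u).norm ≤ N) :
    IsLink N (e.symm u) (f.symm u) := by
  choose σ hσ using h
  have hσi : Function.Injective σ := fun l m hlm => letter_injective (e.injective (by
    rw [hσ, hσ, hlm]))
  have hσs : Function.Surjective σ := Finite.surjective_of_injective hσi
  set ω := e.trans f.symm with hω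
  have h1 : ∀ l, ω (letter l) = letter (σ l) := fun l => by simp [hω, hσ]
  have h2 : ∀ l, ∃ m, ω.symm (letter l) = letter m := by
    intro l
    obtain ⟨m, rfl⟩ := hσs l
    exact ⟨m, by rw [← h1, MulEquiv.symm_apply_apply]⟩
  have h3 : ω (e.symm u) = f.symm u := by simp [hω]
  refine ⟨hN, ?_, ω, fun i => ⟨?_, ?_⟩, h3⟩
  · rw [← h3]
    exact (norm_map_le_of_letter (ω := ω.toMonoidHom)
      (fun l => ((congrArg _ (h1 l)).trans (norm_letter _)).le) _).trans hN
  · rw [← letter_true, h1, norm_letter]; norm_num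
  · obtain ⟨m, hm⟩ := h2 (i, true)
    rw [← letter_true, hm, norm_letter]; norm_num

/-- **Whitehead's theorem**: elements in one orbit under automorphisms are connected by small
automorphisms without exceeding the larger of their norms. -/
theorem links_of_apply_eq {N : ℕ} {x : FreeGroup α} (φ : FreeGroup α ≃* FreeGroup α)
    (hx : x.norm ≤ N) (hφ : (φ x).norm ≤ N) : Relation.ReflTransGen (IsLink N) x (φ x) := by
  -- In these two bases the words of `x` are the words of `x` and of `φ x` in the letters.
  obtain ⟨e, f, he, hf, h⟩ := exists_common_descent x (MulEquiv.refl _) φ.symm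
  have h1 := he.links hx
  have h2 := hf.links hφ
  have h3 := isLink_of_letter_eq h (u := x) (he.norm_le.trans hx)
  have h4 : Relation.ReflTransGen (IsLink N) (f.symm x) (φ x) := by
    rw [← Relation.reflTransGen_swap]
    exact Relation.ReflTransGen.mono (fun _ _ h => IsLink.symm h) _ _ h2
  exact (h1.tail h3).trans h4

/-- If the orbit of `x` meets the free factor generated by the letters in `R`, then it does so in
an element connected to `x` by small automorphisms without exceeding the norm of `x`. -/
theorem exists_links_of_letters_mem {x : FreeGroup α} (φ : FreeGroup α ≃* FreeGroup α) {R : Set α}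
    (hR : ∀ p ∈ (φ x).toWord, p.1 ∈ R) :
    ∃ y, Relation.ReflTransGen (IsLink x.norm) x y ∧ ∀ p ∈ y.toWord, p.1 ∈ R := by
  obtain ⟨e, f, he, hf, h⟩ := exists_common_descent x (MulEquiv.refl _) φ.symm
  -- The end of the descent from `φ.symm` has both properties: it uses only letters occurring in `φ
  -- x`, and it is one link from the end of the descent from the identity, which stays within the
  -- norm of `x`.
  refine ⟨f.symm x, (he.links le_rfl).tail (isLink_of_letter_eq h he.norm_le), fun p hp => ?_⟩
  by_contra hpR
  have h0 : occurrences φ.symm x p.1 = 0 := by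
    rw [occurrences_eq_zero_iff]
    rintro q hq hqp
    exact hpR (hqp ▸ hR q hq)
  have h1 := hf.occurrences_le p.1
  rw [h0, Nat.le_zero, occurrences_eq_zero_iff] at h1
  exact h1 p hp rfl

end Whitehead

/-! ### Lengths of powers. -/

section Powers

variable {α : Type*} [DecidableEq α]

/-- Write `g` as a conjugate of a nonempty cyclically reduced word: its powers are concatenated
without cancellation between the conjugators. -/
theorem le_norm_pow {g : FreeGroup α} (hg : g ≠ 1) (k : ℕ) : k ≤ (g ^ k).norm := by
  cases k with
  | zero => simp
  | succ k =>
    have hrc : FreeGroup.reduceCyclically g.toWord ≠ [] := by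
      intro h
      have h1 := FreeGroup.reduceCyclically.conj_conjugator_reduceCyclically g.toWord
      rw [h, List.append_nil] at h1
      apply hg
      rw [← FreeGroup.mk_toWord (x := g), ← h1, ← FreeGroup.mul_mk, ← FreeGroup.inv_mk,
        mul_inv_cancel]
    have h2 := List.length_pos_iff.2 hrc
    rw [FreeGroup.norm, FreeGroup.toWord_pow,
      FreeGroup.reduceCyclically.reduce_flatten_replicate_succ FreeGroup.isReduced_toWord]
    simp only [List.length_append, List.length_flatten, List.map_replicate, List.sum_replicate,
      smul_eq_mul]
    nlinarith

theorem natAbs_le_norm_zpow {g : FreeGroup α} (hg : g ≠ 1) (k : ℤ) :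
    k.natAbs ≤ (g ^ k).norm := by
  rcases Int.natAbs_eq k with h | h
  · conv_rhs => rw [h]
    rw [zpow_natCast]
    exact le_norm_pow hg _
  · conv_rhs => rw [h]
    rw [zpow_neg, zpow_natCast, FreeGroup.norm_inv_eq]
    exact le_norm_pow hg _

theorem freeGroup_norm_pow_le (g : FreeGroup α) (k : ℕ) : (g ^ k).norm ≤ k * g.norm := by
  induction k with
  | zero => simp
  | succ k ih =>
    rw [pow_succ, add_mul, one_mul]
    exact (FreeGroup.norm_mul_le _ _).trans (by gcongr)

end Powers

/-! ### Free factors as subgroups generated by letters. -/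

section FreeFactors

theorem letters_mem_iff {α : Type*} [DecidableEq α] (R : Set α) (x : FreeGroup α) :
    (∀ p ∈ x.toWord, p.1 ∈ R) ↔ x ∈ Subgroup.closure (FreeGroup.of '' R) := by
  constructor
  · have key : ∀ L : List (α × Bool), (∀ p ∈ L, p.1 ∈ R) →
        FreeGroup.mk L ∈ Subgroup.closure (FreeGroup.of '' R) := by
      intro L
      induction L with
      | nil => intro _; exact one_mem _
      | cons a L ih =>
        intro h
        rw [← letter_mul_mk]
        refine mul_mem ?_ (ih fun p hp => h p (List.mem_cons_of_mem _ hp))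
        have ha : FreeGroup.of a.1 ∈ Subgroup.closure (FreeGroup.of '' R) :=
          Subgroup.subset_closure ⟨a.1, h a List.mem_cons_self, rfl⟩
        obtain ⟨i, b⟩ := a
        cases b
        · rw [letter_false]; exact inv_mem ha
        · exact ha
    intro h
    have := key _ h
    rwa [FreeGroup.mk_toWord] at this
  · intro hx
    induction hx using Subgroup.closure_induction with
    | mem x hx =>
      obtain ⟨i, hi, rfl⟩ := hx
      simpa using hi
    | one => simp
    | mul x y _ _ hx hy =>
      intro p hp
      rcases List.mem_append.1 ((FreeGroup.toWord_mul_sublist x y).mem hp) with h | h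
      · exact hx p h
      · exact hy p h
    | inv x _ hx =>
      intro p hp
      rw [FreeGroup.toWord_inv] at hp
      simp only [FreeGroup.invRev, List.mem_reverse, List.mem_map] at hp
      obtain ⟨q, hq, rfl⟩ := hp
      exact hx q hq

/-- A free factor of a free group is carried to a subgroup generated by letters by some
automorphism. -/
theorem IsFreeFactor.exists_mulEquiv {α : Type*} {H : Subgroup (FreeGroup α)}
    (hH : IsFreeFactor H) : ∃ (θ : FreeGroup α ≃* FreeGroup α) (R : Set α),
      H = (Subgroup.closure (FreeGroup.of '' R)).comap θ.toMonoidHom := by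
  obtain ⟨K, hK⟩ := hH
  let E := MulEquiv.ofBijective _ hK
  -- Subgroups of free groups are free, and bases of the two factors together form a basis of the
  -- whole group.
  let bH := IsFreeGroup.basis H
  let bK := IsFreeGroup.basis K
  let F : FreeGroup (IsFreeGroup.Generators H ⊕ IsFreeGroup.Generators K) →* FreeGroup α :=
    FreeGroup.lift (Sum.elim (fun a => (bH a : FreeGroup α)) fun b => (bK b : FreeGroup α))
  let F' : Monoid.Coprod H K →*
      FreeGroup (IsFreeGroup.Generators H ⊕ IsFreeGroup.Generators K) :=
    Monoid.Coprod.lift (bH.lift fun a => FreeGroup.of (Sum.inl a))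
      (bK.lift fun b => FreeGroup.of (Sum.inr b))
  have hliftH : ∀ a, bH.lift (fun a => FreeGroup.of (Sum.inl a) :
      _ → FreeGroup (IsFreeGroup.Generators H ⊕ IsFreeGroup.Generators K)) (bH a) =
        FreeGroup.of (Sum.inl a) := fun a => by
    exact congrFun (bH.lift.symm_apply_apply _) a
  have hliftK : ∀ b, bK.lift (fun b => FreeGroup.of (Sum.inr b) :
      _ → FreeGroup (IsFreeGroup.Generators H ⊕ IsFreeGroup.Generators K)) (bK b) =
        FreeGroup.of (Sum.inr b) := fun b => by
    exact congrFun (bK.lift.symm_apply_apply _) b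
  have hEl : ∀ x : H, E (Monoid.Coprod.inl x) = x := fun x => by
    simp [E]
  have hEr : ∀ x : K, E (Monoid.Coprod.inr x) = x := fun x => by
    simp [E]
  have h1 : (F'.comp E.symm.toMonoidHom).comp F = MonoidHom.id _ := by
    ext (a | b)
    · have : E.symm (bH a : FreeGroup α) = Monoid.Coprod.inl (bH a) := by
        rw [MulEquiv.symm_apply_eq, hEl]
      simp [F, F', this, hliftH]
    · have : E.symm (bK b : FreeGroup α) = Monoid.Coprod.inr (bK b) := by
        rw [MulEquiv.symm_apply_eq, hEr]
      simp [F, F', this, hliftK]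
  have h2' : F.comp F' = E.toMonoidHom := by
    apply Monoid.Coprod.hom_ext
    · apply bH.ext_hom
      intro a
      simp [F, F', hliftH, hEl]
    · apply bK.ext_hom
      intro b
      simp [F, F', hliftK, hEr]
  have h2 : F.comp (F'.comp E.symm.toMonoidHom) = MonoidHom.id _ := by
    rw [← MonoidHom.comp_assoc, h2']
    ext; simp
  let Θ := MonoidHom.toMulEquiv F (F'.comp E.symm.toMonoidHom) h1 h2
  -- Bases of one free group are equinumerous, so the combined basis can be relabelled by the
  -- original letters.
  let σ := Equiv.ofFreeGroupEquiv Θ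
  refine ⟨Θ.symm.trans (FreeGroup.freeGroupCongr σ), Set.range fun a => σ (Sum.inl a), ?_⟩
  have hgen : ∀ a, Θ.symm.trans (FreeGroup.freeGroupCongr σ) (bH a) =
      FreeGroup.of (σ (Sum.inl a)) := by
    intro a
    have : Θ.symm (bH a : FreeGroup α) = FreeGroup.of (Sum.inl a) := by
      rw [MulEquiv.symm_apply_eq]
      simp [Θ, F]
    simp [this]
  have hHcl : H = Subgroup.closure (Set.range fun a => (bH a : FreeGroup α)) := by
    have hr : (FreeGroup.lift fun a => (bH a : FreeGroup α)).range = H := by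
      have : (FreeGroup.lift fun a => (bH a : FreeGroup α)) =
          H.subtype.comp bH.repr.symm.toMonoidHom := by
        ext a; simp; rfl
      rw [this, MonoidHom.range_comp, MonoidHom.range_eq_top.2 bH.repr.symm.surjective,
        ← MonoidHom.range_eq_map, Subgroup.range_subtype]
    rw [FreeGroup.range_lift_eq_closure] at hr
    exact hr.symm
  set θ := Θ.symm.trans (FreeGroup.freeGroupCongr σ) with hθ
  have himg : Subgroup.closure (FreeGroup.of '' Set.range fun a => σ (Sum.inl a)) =
      H.map θ.toMonoidHom := by
    conv_rhs => rw [hHcl]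
    rw [MonoidHom.map_closure, ← Set.range_comp, ← Set.range_comp]
    congr 2
    funext a
    exact (hgen a).symm
  rw [himg, Subgroup.comap_map_eq_self_of_injective θ.injective]

end FreeFactors

/-! ### Primitive recursive predicates and unbounded search. -/

section PrimitiveRecursion

variable {α β γ σ : Type*} [Primcodable α] [Primcodable β] [Primcodable γ] [Primcodable σ]

theorem PrimrecPred.forall_mem {f : γ → List α} (hf : Primrec f) {R : γ → α → Prop}
    (hR : PrimrecRel R) : PrimrecPred fun c => ∀ a ∈ f c, R c a :=
  (PrimrecRel.forall_mem_list hR.swap).comp hf Primrec.id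

theorem PrimrecPred.exists_mem {f : γ → List α} (hf : Primrec f) {R : γ → α → Prop}
    (hR : PrimrecRel R) : PrimrecPred fun c => ∃ a ∈ f c, R c a :=
  (PrimrecRel.exists_mem_list hR.swap).comp hf Primrec.id

theorem PrimrecPred.imp {p q : γ → Prop} (hp : PrimrecPred p) (hq : PrimrecPred q) :
    PrimrecPred fun c => p c → q c :=
  (hp.not.or hq).of_eq fun _ => imp_iff_not_or.symm

theorem PrimrecPred.mem {f : γ → α} {g : γ → List α} (hf : Primrec f) (hg : Primrec g) :
    PrimrecPred fun c => f c ∈ g c :=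
  (PrimrecPred.exists_mem hg (R := fun c a => a = f c)
    (Primrec.eq.comp Primrec.snd (hf.comp Primrec.fst))).of_eq fun c => by simp

theorem PrimrecPred.eq {f g : γ → α} (hf : Primrec f) (hg : Primrec g) :
    PrimrecPred fun c => f c = g c := Primrec.eq.comp hf hg

theorem PrimrecPred.le {f g : γ → ℕ} (hf : Primrec f) (hg : Primrec g) :
    PrimrecPred fun c => f c ≤ g c := Primrec.nat_le.comp hf hg

theorem PrimrecPred.lt {f g : γ → ℕ} (hf : Primrec f) (hg : Primrec g) :
    PrimrecPred fun c => f c < g c := Primrec.nat_lt.comp hf hg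

/-- Unbounded search for a pair of an answer and a certificate for it. -/
theorem exists_partrec_search {R : α → σ × β → Prop} (hR : PrimrecRel R) :
    ∃ f : α →. σ, Partrec f ∧ (∀ a, ∀ b ∈ f a, ∃ c, R a (b, c)) ∧
      ∀ a b c, R a (b, c) → (f a).Dom := by
  classical
  let g : α → ℕ → Option σ := fun a k =>
    (Encodable.decode (α := σ × β) k).bind fun c => if R a c then some c.1 else none
  have hg : Primrec₂ g := by
    refine Primrec.option_bind (Primrec.decode.comp Primrec.snd) ?_
    refine Primrec.ite (hR.comp (Primrec.fst.comp Primrec.fst) Primrec.snd) ?_ (Primrec.const none)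
    exact Primrec.option_some.comp (Primrec.fst.comp Primrec.snd)
  refine ⟨fun a => Nat.rfindOpt (g a), Partrec.rfindOpt hg.to_comp, fun a b hb => ?_,
    fun a b c h => ?_⟩
  · obtain ⟨k, hk⟩ := Nat.rfindOpt_spec hb
    simp only [g, Option.mem_def, Option.bind_eq_some_iff] at hk
    obtain ⟨⟨b', c⟩, -, hc⟩ := hk
    split_ifs at hc with h
    obtain rfl : b' = b := by simpa using hc
    exact ⟨c, h⟩
  · rw [Nat.rfindOpt_dom]
    exact ⟨Encodable.encode (b, c), b, by simp [g, h]⟩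

end PrimitiveRecursion

/-! ### Computing with words, and certificates. -/

section Words

/-- One step of free reduction. -/
def reduceStep (x : ℕ × Bool) (L : List (ℕ × Bool)) : List (ℕ × Bool) :=
  List.casesOn L [x] fun hd tl => if x.1 = hd.1 ∧ x.2 = not hd.2 then tl else x :: hd :: tl

theorem reduce_eq_foldr (L : List (ℕ × Bool)) :
    FreeGroup.reduce L = L.foldr reduceStep [] := by
  induction L with
  | nil => rfl
  | cons x L ih => rw [FreeGroup.reduce.cons, List.foldr_cons, ← ih]; rfl

theorem primrec_reduceStep : Primrec₂ reduceStep := by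
  have hx : Primrec fun p : ((ℕ × Bool) × List (ℕ × Bool)) × ((ℕ × Bool) × List (ℕ × Bool)) =>
    p.1.1 := Primrec.fst.comp Primrec.fst
  have hhd : Primrec fun p : ((ℕ × Bool) × List (ℕ × Bool)) × ((ℕ × Bool) × List (ℕ × Bool)) =>
    p.2.1 := Primrec.fst.comp Primrec.snd
  have htl : Primrec fun p : ((ℕ × Bool) × List (ℕ × Bool)) × ((ℕ × Bool) × List (ℕ × Bool)) =>
    p.2.2 := Primrec.snd.comp Primrec.snd
  refine Primrec.list_casesOn (f := fun p : (ℕ × Bool) × List (ℕ × Bool) => p.2)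
    (g := fun p => [p.1])
    (h := fun p q => if p.1.1 = q.1.1 ∧ p.1.2 = not q.1.2 then q.2 else p.1 :: q.1 :: q.2)
    Primrec.snd (Primrec.list_cons.comp Primrec.fst (Primrec.const [])) ?_
  refine Primrec.ite (PrimrecPred.and ?_ ?_) htl
    (Primrec.list_cons.comp hx (Primrec.list_cons.comp hhd htl))
  · exact PrimrecPred.eq (Primrec.fst.comp hx) (Primrec.fst.comp hhd)
  · exact PrimrecPred.eq (Primrec.snd.comp hx) (Primrec.not.comp (Primrec.snd.comp hhd))

theorem primrec_reduce : Primrec (FreeGroup.reduce : List (ℕ × Bool) → List (ℕ × Bool)) :=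
  (Primrec.list_foldr (h := fun _ p => reduceStep p.1 p.2) Primrec.id (Primrec.const [])
    (primrec_reduceStep.comp (Primrec.fst.comp Primrec.snd)
      (Primrec.snd.comp Primrec.snd)).to₂).of_eq fun L => (reduce_eq_foldr L).symm

theorem primrec_invRev : Primrec (FreeGroup.invRev : List (ℕ × Bool) → List (ℕ × Bool)) :=
  Primrec.list_reverse.comp (Primrec.list_map Primrec.id
    (Primrec.pair (Primrec.fst.comp Primrec.snd)
      (Primrec.not.comp (Primrec.snd.comp Primrec.snd))).to₂)

/-- The word substituted for a letter. -/
def substLetter (μ : List (List (ℕ × Bool))) (p : ℕ × Bool) : List (ℕ × Bool) :=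
  bif p.2 then μ.getD p.1 [] else FreeGroup.invRev (μ.getD p.1 [])

/-- Substitution of the words of a list for the letters. -/
def subst (μ : List (List (ℕ × Bool))) (w : List (ℕ × Bool)) : List (ℕ × Bool) :=
  w.flatMap (substLetter μ)

theorem primrec_substLetter : Primrec₂ substLetter := by
  have h : Primrec fun x : List (List (ℕ × Bool)) × (ℕ × Bool) => x.1.getD x.2.1 [] :=
    (Primrec.list_getD []).comp Primrec.fst (Primrec.fst.comp Primrec.snd)
  exact Primrec.cond (Primrec.snd.comp Primrec.snd) h (primrec_invRev.comp h)

theorem primrec_subst : Primrec₂ subst :=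
  Primrec.list_flatMap Primrec.snd
    (primrec_substLetter.comp (Primrec.fst.comp Primrec.fst) Primrec.snd).to₂

/-- The lists of length `k` with entries in `L`. -/
def listsOf {β : Type*} (L : List β) (k : ℕ) : List (List β) :=
  Nat.rec [[]] (fun _ acc => acc.flatMap fun t => L.map fun a => a :: t) k

theorem mem_listsOf {β : Type*} {L : List β} {k : ℕ} {t : List β} :
    t ∈ listsOf L k ↔ t.length = k ∧ ∀ a ∈ t, a ∈ L := by
  induction k generalizing t with
  | zero => simp +contextual [listsOf]
  | succ k ih =>
    change t ∈ (listsOf L k).flatMap _ ↔ _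
    simp only [List.mem_flatMap, ih, List.mem_map]
    constructor
    · rintro ⟨s, ⟨hs, hs'⟩, a, ha, rfl⟩
      exact ⟨by simp [hs], by simpa [ha] using hs'⟩
    · rintro ⟨h1, h2⟩
      cases t with
      | nil => simp at h1
      | cons a t => exact ⟨t, ⟨by simpa using h1, fun b hb => h2 b (by simp [hb])⟩, a,
          h2 a (by simp), rfl⟩

theorem primrec_listsOf {β : Type*} [Primcodable β] : Primrec₂ (listsOf (β := β)) := by
  refine Primrec.nat_rec (f := fun _ : List β => [[]])
    (g := fun (L : List β) (p : ℕ × List (List β)) => p.2.flatMap fun t => L.map fun a => a :: t)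
    (Primrec.const _) ?_
  refine Primrec.list_flatMap (Primrec.snd.comp Primrec.snd) ?_
  refine Primrec.list_map (Primrec.fst.comp Primrec.fst) ?_
  exact (Primrec.list_cons.comp Primrec.snd (Primrec.snd.comp Primrec.fst)).to₂

/-- The letters of the free group of rank `n`. -/
def lettersBelow (n : ℕ) : List (ℕ × Bool) :=
  (List.range n).flatMap fun i => [(i, true), (i, false)]

theorem mem_lettersBelow {n : ℕ} {p : ℕ × Bool} : p ∈ lettersBelow n ↔ p.1 < n := by
  obtain ⟨i, b⟩ := p
  cases b <;> simp [lettersBelow]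

theorem primrec_lettersBelow : Primrec lettersBelow := by
  refine Primrec.list_flatMap Primrec.list_range ?_
  refine (Primrec.list_cons.comp (Primrec.pair Primrec.snd (Primrec.const true))
    (Primrec.list_cons.comp (Primrec.pair Primrec.snd (Primrec.const false))
      (Primrec.const []))).to₂

/-- The substitutions of words of length at most three for the letters. -/
def smallSubsts (n : ℕ) : List (List (List (ℕ × Bool))) :=
  listsOf ((List.range 4).flatMap (listsOf (lettersBelow n))) n

theorem mem_smallSubsts {n : ℕ} {μ : List (List (ℕ × Bool))} : μ ∈ smallSubsts n ↔
    μ.length = n ∧ ∀ w ∈ μ, w.length ≤ 3 ∧ ∀ p ∈ w, p.1 < n := by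
  simp only [smallSubsts, mem_listsOf, List.mem_flatMap, List.mem_range, mem_lettersBelow]
  refine and_congr_right fun _ => forall₂_congr fun w _ => ?_
  constructor
  · rintro ⟨k, hk, rfl, h⟩
    exact ⟨by omega, h⟩
  · rintro ⟨h1, h2⟩
    exact ⟨w.length, by omega, rfl, h2⟩

theorem primrec_smallSubsts : Primrec smallSubsts := by
  refine primrec_listsOf.comp ?_ Primrec.id
  exact Primrec.list_flatMap (Primrec.const _)
    (primrec_listsOf.comp (primrec_lettersBelow.comp Primrec.fst) Primrec.snd).to₂

/-- The substitutions `μ` and `ν` define mutually inverse automorphisms of the free group of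
rank `n`. -/
def IsInversePair (n : ℕ) (μ ν : List (List (ℕ × Bool))) : Prop :=
  μ.length = n ∧ ν.length = n ∧ ∀ i ∈ List.range n,
    FreeGroup.reduce (subst μ (ν.getD i [])) = [(i, true)] ∧
      FreeGroup.reduce (subst ν (μ.getD i [])) = [(i, true)]

theorem primrecPred_isInversePair {γ : Type*} [Primcodable γ] {f : γ → ℕ}
    {g h : γ → List (List (ℕ × Bool))} (hf : Primrec f) (hg : Primrec g) (hh : Primrec h) :
    PrimrecPred fun c => IsInversePair (f c) (g c) (h c) := by
  have key : ∀ {g h : γ → List (List (ℕ × Bool))}, Primrec g → Primrec h →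
      PrimrecPred fun p : γ × ℕ =>
        FreeGroup.reduce (subst (g p.1) ((h p.1).getD p.2 [])) = [(p.2, true)] := by
    intro g h hg hh
    refine PrimrecPred.eq (primrec_reduce.comp (primrec_subst.comp (hg.comp Primrec.fst)
      ((Primrec.list_getD []).comp (hh.comp Primrec.fst) Primrec.snd))) ?_
    exact Primrec.list_cons.comp (Primrec.pair Primrec.snd (Primrec.const true))
      (Primrec.const [])
  refine (PrimrecPred.eq (Primrec.list_length.comp hg) hf).and
    ((PrimrecPred.eq (Primrec.list_length.comp hh) hf).and ?_)
  exact PrimrecPred.forall_mem (Primrec.list_range.comp hf) ((key hg hh).and (key hh hg))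

/-- The list `S` of words is closed under the automorphisms given by small substitutions, as long
as the length does not exceed `N`. -/
def IsClosedList (n N : ℕ) (S : List (List (ℕ × Bool))) : Prop :=
  ∀ w ∈ S, ∀ μ ∈ smallSubsts n, ∀ ν ∈ smallSubsts n, IsInversePair n μ ν →
    (FreeGroup.reduce (subst μ w)).length ≤ N → FreeGroup.reduce (subst μ w) ∈ S

theorem primrecPred_isClosedList {γ : Type*} [Primcodable γ] {f g : γ → ℕ}
    {S : γ → List (List (ℕ × Bool))} (hf : Primrec f) (hg : Primrec g) (hS : Primrec S) :
    PrimrecPred fun c => IsClosedList (f c) (g c) (S c) := by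
  refine PrimrecPred.forall_mem hS (PrimrecPred.forall_mem
    (primrec_smallSubsts.comp (hf.comp Primrec.fst)) (PrimrecPred.forall_mem
      (primrec_smallSubsts.comp (hf.comp (Primrec.fst.comp Primrec.fst))) ?_))
  have hc : Primrec fun x : ((γ × List (ℕ × Bool)) × List (List (ℕ × Bool))) ×
    List (List (ℕ × Bool)) => x.1.1.1 := Primrec.fst.comp (Primrec.fst.comp Primrec.fst)
  have hr : Primrec fun x : ((γ × List (ℕ × Bool)) × List (List (ℕ × Bool))) ×
      List (List (ℕ × Bool)) => FreeGroup.reduce (subst x.1.2 x.1.1.2) :=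
    primrec_reduce.comp (primrec_subst.comp (Primrec.snd.comp Primrec.fst)
      (Primrec.snd.comp (Primrec.fst.comp Primrec.fst)))
  exact (primrecPred_isInversePair (hf.comp hc) (Primrec.snd.comp Primrec.fst)
    Primrec.snd).imp ((PrimrecPred.le (Primrec.list_length.comp hr) (hg.comp hc)).imp
      (PrimrecPred.mem hr (hS.comp hc)))

/-- Certificate for a positive answer. -/
def PositiveCertificate (x : OrbitInput)
    (c : List (List (ℕ × Bool)) × List (List (ℕ × Bool)) × List (ℕ × Bool)) : Prop :=
  IsInversePair x.1 c.1 c.2.1 ∧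
    FreeGroup.reduce (subst c.1 x.2.1) = FreeGroup.reduce (subst x.2.2 c.2.2)

theorem primrecRel_positiveCertificate : PrimrecRel PositiveCertificate := by
  have hμ : Primrec fun p : OrbitInput × (List (List (ℕ × Bool)) × List (List (ℕ × Bool)) ×
    List (ℕ × Bool)) => p.2.1 := Primrec.fst.comp Primrec.snd
  exact (primrecPred_isInversePair (Primrec.fst.comp Primrec.fst) hμ
    (Primrec.fst.comp (Primrec.snd.comp Primrec.snd))).and (PrimrecPred.eq
      (primrec_reduce.comp (primrec_subst.comp hμ (Primrec.fst.comp (Primrec.snd.comp Primrec.fst))))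
      (primrec_reduce.comp (primrec_subst.comp (Primrec.snd.comp (Primrec.snd.comp Primrec.fst))
        (Primrec.snd.comp (Primrec.snd.comp Primrec.snd)))))

/-- The word for the `k`-th power of the first generator or its inverse. -/
def powerWord (k : ℕ) (b : Bool) : List (ℕ × Bool) := (List.range k).map fun _ => (0, b)

theorem primrec_powerWord (b : Bool) : Primrec fun k => powerWord k b :=
  Primrec.list_map Primrec.list_range (Primrec.const (0, b)).to₂

/-- Certificate for a negative answer in the case of a cyclic subgroup: a generator, words for the
given elements in the generator, a length bound, and the words of the orbit up to this length. -/
def CyclicCertificate (x : OrbitInput)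
    (c : List (ℕ × Bool) × List (List (ℕ × Bool)) × ℕ × List (List (ℕ × Bool))) : Prop :=
  ((∀ p ∈ c.1, p.1 < x.1) ∧
    x.2.2.map FreeGroup.reduce = c.2.1.map fun t => FreeGroup.reduce (subst [c.1] t)) ∧
  -- The bound must cover the given word and every power of the generator that could lie in its
  -- orbit; such exponents may be taken at most the length of the word in absolute value.
  (x.2.1.length ≤ c.2.2.1 ∧ x.2.1.length * c.1.length ≤ c.2.2.1) ∧
  (FreeGroup.reduce x.2.1 ∈ c.2.2.2 ∧ IsClosedList x.1 c.2.2.1 c.2.2.2) ∧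
  ∀ k ∈ List.range (x.2.1.length + 1),
    FreeGroup.reduce (subst [c.1] (powerWord k true)) ∉ c.2.2.2 ∧
      FreeGroup.reduce (subst [c.1] (powerWord k false)) ∉ c.2.2.2

theorem primrecRel_cyclicCertificate : PrimrecRel CyclicCertificate := by
  have hn : Primrec fun p : OrbitInput × (List (ℕ × Bool) × List (List (ℕ × Bool)) × ℕ ×
    List (List (ℕ × Bool))) => p.1.1 := Primrec.fst.comp Primrec.fst
  have hu : Primrec fun p : OrbitInput × (List (ℕ × Bool) × List (List (ℕ × Bool)) × ℕ ×
    List (List (ℕ × Bool))) => p.1.2.1 := Primrec.fst.comp (Primrec.snd.comp Primrec.fst)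
  have hg : Primrec fun p : OrbitInput × (List (ℕ × Bool) × List (List (ℕ × Bool)) × ℕ ×
    List (List (ℕ × Bool))) => p.1.2.2 := Primrec.snd.comp (Primrec.snd.comp Primrec.fst)
  have hh : Primrec fun p : OrbitInput × (List (ℕ × Bool) × List (List (ℕ × Bool)) × ℕ ×
    List (List (ℕ × Bool))) => p.2.1 := Primrec.fst.comp Primrec.snd
  have ht : Primrec fun p : OrbitInput × (List (ℕ × Bool) × List (List (ℕ × Bool)) × ℕ ×
    List (List (ℕ × Bool))) => p.2.2.1 := Primrec.fst.comp (Primrec.snd.comp Primrec.snd)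
  have hN : Primrec fun p : OrbitInput × (List (ℕ × Bool) × List (List (ℕ × Bool)) × ℕ ×
    List (List (ℕ × Bool))) => p.2.2.2.1 :=
      Primrec.fst.comp (Primrec.snd.comp (Primrec.snd.comp Primrec.snd))
  have hS : Primrec fun p : OrbitInput × (List (ℕ × Bool) × List (List (ℕ × Bool)) × ℕ ×
    List (List (ℕ × Bool))) => p.2.2.2.2 :=
      Primrec.snd.comp (Primrec.snd.comp (Primrec.snd.comp Primrec.snd))
  have hl := Primrec.list_length.comp hu
  have hsingle : Primrec fun p : OrbitInput × (List (ℕ × Bool) × List (List (ℕ × Bool)) × ℕ ×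
    List (List (ℕ × Bool))) => [p.2.1] := Primrec.list_cons.comp hh (Primrec.const [])
  have hpow : ∀ b, PrimrecPred fun p : (OrbitInput × (List (ℕ × Bool) × List (List (ℕ × Bool)) ×
      ℕ × List (List (ℕ × Bool)))) × ℕ =>
        FreeGroup.reduce (subst [p.1.2.1] (powerWord p.2 b)) ∉ p.1.2.2.2.2 := fun b =>
    (PrimrecPred.mem (primrec_reduce.comp (primrec_subst.comp (hsingle.comp Primrec.fst)
      ((primrec_powerWord b).comp Primrec.snd))) (hS.comp Primrec.fst)).not
  refine PrimrecPred.and (PrimrecPred.and ?_ ?_) (PrimrecPred.and (PrimrecPred.and ?_ ?_)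
    (PrimrecPred.and (PrimrecPred.and ?_ ?_) ?_))
  · exact PrimrecPred.forall_mem hh
      (PrimrecPred.lt (Primrec.fst.comp Primrec.snd) (hn.comp Primrec.fst))
  · exact PrimrecPred.eq (Primrec.list_map hg (primrec_reduce.comp Primrec.snd).to₂)
      (Primrec.list_map ht (primrec_reduce.comp
        (primrec_subst.comp (hsingle.comp Primrec.fst) Primrec.snd)).to₂)
  · exact PrimrecPred.le hl hN
  · exact PrimrecPred.le (Primrec.nat_mul.comp hl (Primrec.list_length.comp hh)) hN
  · exact PrimrecPred.mem (primrec_reduce.comp hu) hS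
  · exact primrecPred_isClosedList hn hN hS
  · exact PrimrecPred.forall_mem (Primrec.list_range.comp (Primrec.succ.comp hl))
      ((hpow true).and (hpow false))

/-- Certificate for a negative answer in the case of a free factor: an automorphism carrying the
subgroup into one generated by letters, these letters, and the words of the orbit up to the length
of the given word. -/
def FreeFactorCertificate (x : OrbitInput)
    (c : List (List (ℕ × Bool)) × List (List (ℕ × Bool)) × List ℕ × List (List (ℕ × Bool))) :
    Prop :=
  (IsInversePair x.1 c.1 c.2.1 ∧
    ∀ g ∈ x.2.2, ∀ p ∈ FreeGroup.reduce (subst c.1 g), p.1 ∈ c.2.2.1) ∧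
  (FreeGroup.reduce x.2.1 ∈ c.2.2.2 ∧
    IsClosedList x.1 (FreeGroup.reduce x.2.1).length c.2.2.2) ∧
  ∀ w ∈ c.2.2.2, ∃ p ∈ w, p.1 ∉ c.2.2.1

theorem primrecRel_freeFactorCertificate : PrimrecRel FreeFactorCertificate := by
  have hn : Primrec fun p : OrbitInput × (List (List (ℕ × Bool)) × List (List (ℕ × Bool)) ×
    List ℕ × List (List (ℕ × Bool))) => p.1.1 := Primrec.fst.comp Primrec.fst
  have hu : Primrec fun p : OrbitInput × (List (List (ℕ × Bool)) × List (List (ℕ × Bool)) ×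
    List ℕ × List (List (ℕ × Bool))) => p.1.2.1 := Primrec.fst.comp (Primrec.snd.comp Primrec.fst)
  have hg : Primrec fun p : OrbitInput × (List (List (ℕ × Bool)) × List (List (ℕ × Bool)) ×
    List ℕ × List (List (ℕ × Bool))) => p.1.2.2 := Primrec.snd.comp (Primrec.snd.comp Primrec.fst)
  have hμ : Primrec fun p : OrbitInput × (List (List (ℕ × Bool)) × List (List (ℕ × Bool)) ×
    List ℕ × List (List (ℕ × Bool))) => p.2.1 := Primrec.fst.comp Primrec.snd
  have hν : Primrec fun p : OrbitInput × (List (List (ℕ × Bool)) × List (List (ℕ × Bool)) ×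
    List ℕ × List (List (ℕ × Bool))) => p.2.2.1 := Primrec.fst.comp (Primrec.snd.comp Primrec.snd)
  have hR : Primrec fun p : OrbitInput × (List (List (ℕ × Bool)) × List (List (ℕ × Bool)) ×
    List ℕ × List (List (ℕ × Bool))) => p.2.2.2.1 :=
      Primrec.fst.comp (Primrec.snd.comp (Primrec.snd.comp Primrec.snd))
  have hS : Primrec fun p : OrbitInput × (List (List (ℕ × Bool)) × List (List (ℕ × Bool)) ×
    List ℕ × List (List (ℕ × Bool))) => p.2.2.2.2 :=
      Primrec.snd.comp (Primrec.snd.comp (Primrec.snd.comp Primrec.snd))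
  refine PrimrecPred.and (PrimrecPred.and ?_ ?_) (PrimrecPred.and (PrimrecPred.and ?_ ?_) ?_)
  · exact primrecPred_isInversePair hn hμ hν
  · exact PrimrecPred.forall_mem hg (PrimrecPred.forall_mem
      (primrec_reduce.comp (primrec_subst.comp (hμ.comp Primrec.fst) Primrec.snd))
      (PrimrecPred.mem (Primrec.fst.comp Primrec.snd)
        (hR.comp (Primrec.fst.comp Primrec.fst))))
  · exact PrimrecPred.mem (primrec_reduce.comp hu) hS
  · exact primrecPred_isClosedList hn (Primrec.list_length.comp (primrec_reduce.comp hu)) hS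
  · exact PrimrecPred.forall_mem hS (PrimrecPred.exists_mem Primrec.snd
      (PrimrecPred.mem (Primrec.fst.comp Primrec.snd)
        (hR.comp (Primrec.fst.comp Primrec.fst))).not)

end Words

/-! ### Translation between rank `n` and words on the tape. -/

section Coding

/-- Letters of the free group of rank `n` are read as natural numbers. -/
def codeHom (n : ℕ) : FreeGroup (Fin n) →* FreeGroup ℕ := FreeGroup.map Fin.val

/-- The retraction onto the free group of rank `n` that kills the other letters. -/
def decodeHom (n : ℕ) : FreeGroup ℕ →* FreeGroup (Fin n) :=
  FreeGroup.lift fun i => if h : i < n then FreeGroup.of ⟨i, h⟩ else 1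

/-- The endomorphism given by a substitution. -/
def substHom (μ : List (List (ℕ × Bool))) : FreeGroup ℕ →* FreeGroup ℕ :=
  FreeGroup.lift fun i => FreeGroup.mk (μ.getD i [])

theorem decodeHom_codeHom {n : ℕ} (x : FreeGroup (Fin n)) : decodeHom n (codeHom n x) = x := by
  have : (decodeHom n).comp (codeHom n) = MonoidHom.id _ := by
    ext i; simp [decodeHom, codeHom]
  exact DFunLike.congr_fun this x

theorem codeHom_injective (n : ℕ) : Function.Injective (codeHom n) :=
  Function.LeftInverse.injective decodeHom_codeHom

theorem mk_code {n : ℕ} (w : GroupWord n) : FreeGroup.mk w.code = codeHom n (FreeGroup.mk w) := by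
  simp [codeHom, GroupWord.code]

theorem toWord_codeHom {n : ℕ} (x : FreeGroup (Fin n)) :
    (codeHom n x).toWord = GroupWord.code x.toWord := by
  conv_lhs => rw [← FreeGroup.mk_toWord (x := x), ← mk_code]
  rw [FreeGroup.toWord_mk, FreeGroup.IsReduced.reduce_eq]
  have h := FreeGroup.isReduced_toWord (x := x)
  unfold FreeGroup.IsReduced GroupWord.code at *
  rw [List.isChain_map]
  refine h.imp fun a b hab h => hab (Fin.ext h)

theorem norm_codeHom {n : ℕ} (x : FreeGroup (Fin n)) : (codeHom n x).norm = x.norm := by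
  rw [FreeGroup.norm, toWord_codeHom, GroupWord.code, List.length_map, FreeGroup.norm]

theorem reduce_code {n : ℕ} (w : GroupWord n) :
    FreeGroup.reduce w.code = (codeHom n (FreeGroup.mk w)).toWord := by
  rw [← mk_code, FreeGroup.toWord_mk]

theorem mk_subst (μ : List (List (ℕ × Bool))) (w : List (ℕ × Bool)) :
    FreeGroup.mk (subst μ w) = substHom μ (FreeGroup.mk w) := by
  induction w with
  | nil => simp [subst, ← FreeGroup.one_eq_mk]
  | cons a w ih =>
    have h : FreeGroup.mk (substLetter μ a) = substHom μ (letter a) := by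
      obtain ⟨i, b⟩ := a
      cases b
      · rw [letter_false, map_inv]
        simp [substLetter, substHom, ← FreeGroup.inv_mk]
      · simp [substLetter, substHom, letter_true]
    rw [← letter_mul_mk, map_mul, ← ih, ← h, FreeGroup.mul_mk]
    rfl

theorem reduce_subst (μ : List (List (ℕ × Bool))) (w : List (ℕ × Bool)) :
    FreeGroup.reduce (subst μ w) = (substHom μ (FreeGroup.mk w)).toWord := by
  rw [← mk_subst, FreeGroup.toWord_mk]

theorem reduce_subst_code {n : ℕ} (μ : List (List (ℕ × Bool))) (w : GroupWord n) :
    FreeGroup.reduce (subst μ w.code) = (substHom μ (codeHom n (FreeGroup.mk w))).toWord := by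
  rw [reduce_subst, mk_code]

/-- A letter with index at least `n` is killed by `decodeHom`, and also by the substitution, whose
default value is the empty word. -/
theorem decodeHom_substHom {n : ℕ} {μ : List (List (ℕ × Bool))} (hμ : μ.length = n)
    (x : FreeGroup ℕ) : decodeHom n (substHom μ (codeHom n (decodeHom n x))) =
      decodeHom n (substHom μ x) := by
  have : ((decodeHom n).comp (substHom μ)).comp ((codeHom n).comp (decodeHom n)) =
      (decodeHom n).comp (substHom μ) := by
    ext i
    by_cases hi : i < n
    · simp [decodeHom, codeHom, substHom, hi]
    · have : μ[i]? = none := by rw [List.getElem?_eq_none_iff]; omega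
      simp [decodeHom, codeHom, substHom, hi, this, ← FreeGroup.one_eq_mk]
  exact DFunLike.congr_fun this x

/-- An inverse pair of substitutions defines an automorphism. -/
theorem IsInversePair.exists_mulEquiv {n : ℕ} {μ ν : List (List (ℕ × Bool))}
    (h : IsInversePair n μ ν) : ∃ φ : FreeGroup (Fin n) ≃* FreeGroup (Fin n),
      ∀ x, φ x = decodeHom n (substHom μ (codeHom n x)) := by
  obtain ⟨hμ, hν, h⟩ := h
  have key : ∀ {μ ν : List (List (ℕ × Bool))}, μ.length = n →
      (∀ i < n, FreeGroup.reduce (subst μ (ν.getD i [])) = [(i, true)]) →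
      ((decodeHom n).comp ((substHom μ).comp (codeHom n))).comp
        ((decodeHom n).comp ((substHom ν).comp (codeHom n))) = MonoidHom.id _ := by
    intro μ ν hμ h
    ext i
    simp only [MonoidHom.comp_apply, decodeHom_substHom hμ, MonoidHom.id_apply]
    have h1 : substHom ν (codeHom n (FreeGroup.of i)) = FreeGroup.mk (ν.getD i []) := by
      simp [substHom, codeHom]
    have h2 := h i i.2
    rw [reduce_subst] at h2
    have h3 : substHom μ (FreeGroup.mk (ν.getD i [])) = FreeGroup.of (i : ℕ) := by
      rw [← FreeGroup.toWord_inj, h2, FreeGroup.toWord_of]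
    rw [h1, h3]
    simp [decodeHom]
  refine ⟨MonoidHom.toMulEquiv _ _
    (key hν fun i hi => (h i (List.mem_range.2 hi)).2)
    (key hμ fun i hi => (h i (List.mem_range.2 hi)).1), fun x => rfl⟩

/-- The substitution that describes an automorphism. -/
def codeAut {n : ℕ} (φ : FreeGroup (Fin n) ≃* FreeGroup (Fin n)) : List (List (ℕ × Bool)) :=
  List.ofFn fun i => GroupWord.code (φ (FreeGroup.of i)).toWord

theorem codeAut_getD {n : ℕ} (φ : FreeGroup (Fin n) ≃* FreeGroup (Fin n)) (i : Fin n) :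
    (codeAut φ).getD i [] = GroupWord.code (φ (FreeGroup.of i)).toWord := by
  simp [codeAut]

theorem substHom_codeAut {n : ℕ} (φ : FreeGroup (Fin n) ≃* FreeGroup (Fin n))
    (x : FreeGroup (Fin n)) : substHom (codeAut φ) (codeHom n x) = codeHom n (φ x) := by
  have : (substHom (codeAut φ)).comp (codeHom n) = (codeHom n).comp φ.toMonoidHom := by
    ext i
    have h := codeAut_getD φ i
    have h' : substHom (codeAut φ) (codeHom n (FreeGroup.of i)) =
        FreeGroup.mk ((codeAut φ).getD i []) := by simp [substHom, codeHom]
    simp only [MonoidHom.comp_apply, h', h, mk_code, FreeGroup.mk_toWord]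
    rfl
  exact DFunLike.congr_fun this x

theorem isInversePair_codeAut {n : ℕ} (φ : FreeGroup (Fin n) ≃* FreeGroup (Fin n)) :
    IsInversePair n (codeAut φ) (codeAut φ.symm) := by
  have key : ∀ (φ : FreeGroup (Fin n) ≃* FreeGroup (Fin n)) (i : ℕ), i < n →
      FreeGroup.reduce (subst (codeAut φ) ((codeAut φ.symm).getD i [])) = [(i, true)] := by
    intro φ i hi
    have := codeAut_getD φ.symm ⟨i, hi⟩
    simp only at this
    rw [this, reduce_subst_code, FreeGroup.mk_toWord, substHom_codeAut, MulEquiv.apply_symm_apply]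
    simp [codeHom]
  refine ⟨by simp [codeAut], by simp [codeAut], fun i hi => ⟨?_, ?_⟩⟩
  · exact key φ i (List.mem_range.1 hi)
  · exact key φ.symm i (List.mem_range.1 hi)

theorem codeAut_mem_smallSubsts {n : ℕ} {ω : FreeGroup (Fin n) ≃* FreeGroup (Fin n)}
    (h : IsSmall ω) : codeAut ω ∈ smallSubsts n := by
  rw [mem_smallSubsts]
  refine ⟨by simp [codeAut], fun w hw => ?_⟩
  obtain ⟨i, rfl⟩ := (List.mem_ofFn' _ _).1 hw
  refine ⟨?_, fun p hp => ?_⟩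
  · simpa [GroupWord.code, FreeGroup.norm] using (h i).1
  · simp only [GroupWord.code, List.mem_map] at hp
    obtain ⟨q, -, rfl⟩ := hp
    exact q.1.2

theorem exists_codeHom_eq_mk {n : ℕ} {w : List (ℕ × Bool)} (h : ∀ p ∈ w, p.1 < n) :
    ∃ y, codeHom n y = FreeGroup.mk w := by
  induction w with
  | nil => exact ⟨1, by simp [← FreeGroup.one_eq_mk]⟩
  | cons a w ih =>
    obtain ⟨y, hy⟩ := ih fun p hp => h p (List.mem_cons_of_mem _ hp)
    have ha := h a List.mem_cons_self
    refine ⟨letter (⟨a.1, ha⟩, a.2) * y, ?_⟩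
    rw [map_mul, hy, ← letter_mul_mk]
    rfl

/-- A substitution using only the letters below `n` preserves the free group of rank `n`. -/
theorem substHom_eq_codeHom {n : ℕ} {μ : List (List (ℕ × Bool))}
    (h : ∀ w ∈ μ, ∀ p ∈ w, p.1 < n) (x : FreeGroup (Fin n)) :
    substHom μ (codeHom n x) = codeHom n (decodeHom n (substHom μ (codeHom n x))) := by
  have hr : ∀ i, substHom μ (FreeGroup.of i) ∈ (codeHom n).range := by
    intro i
    simp only [substHom, FreeGroup.lift_apply_of]
    apply exists_codeHom_eq_mk
    intro p hp
    by_cases hi : i < μ.length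
    · rw [List.getD_eq_getElem _ _ hi] at hp
      exact h _ (List.getElem_mem hi) p hp
    · rw [List.getD_eq_default _ _ (not_lt.1 hi)] at hp
      simp at hp
  have hle : ((substHom μ).comp (codeHom n)).range ≤ (codeHom n).range := by
    have : (substHom μ).comp (codeHom n) =
        FreeGroup.lift fun i : Fin n => substHom μ (FreeGroup.of (i : ℕ)) := by
      ext i; simp [codeHom]
    rw [this]
    apply FreeGroup.range_lift_le
    rintro _ ⟨i, rfl⟩
    exact hr i
  obtain ⟨y, hy⟩ := hle ⟨x, rfl⟩
  change codeHom n y = substHom μ (codeHom n x) at hy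
  rw [← hy, decodeHom_codeHom]

/-- A closed list contains everything that can be reached by links. -/
theorem IsClosedList.mem_of_links {n N : ℕ} {S : List (List (ℕ × Bool))}
    (hS : IsClosedList n N S) {x y : FreeGroup (Fin n)}
    (hx : (codeHom n x).toWord ∈ S) (h : Relation.ReflTransGen (IsLink N) x y) :
    (codeHom n y).toWord ∈ S := by
  induction h with
  | refl => exact hx
  | tail _ h ih =>
    obtain ⟨-, h2, ω, hω, rfl⟩ := h
    have := hS _ ih _ (codeAut_mem_smallSubsts hω) _ (codeAut_mem_smallSubsts hω.symm)
      (isInversePair_codeAut ω)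
    rw [reduce_subst, FreeGroup.mk_toWord, substHom_codeAut] at this
    apply this
    rw [← norm_codeHom] at h2
    exact h2

/-- The words of bounded length in an orbit form a closed list. -/
theorem exists_isClosedList_orbit {n : ℕ} (u : FreeGroup (Fin n)) (N : ℕ) :
    ∃ S, IsClosedList n N S ∧ ∀ w, w ∈ S ↔
      ∃ φ : FreeGroup (Fin n) ≃* FreeGroup (Fin n),
        (φ u).norm ≤ N ∧ w = (codeHom n (φ u)).toWord := by
  have hfin : {w | ∃ φ : FreeGroup (Fin n) ≃* FreeGroup (Fin n),
        (φ u).norm ≤ N ∧ w = (codeHom n (φ u)).toWord}.Finite := by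
    refine ((List.finite_length_le (Fin n × Bool) N).image GroupWord.code).subset ?_
    rintro _ ⟨φ, hφ, rfl⟩
    exact ⟨(φ u).toWord, hφ, (toWord_codeHom _).symm⟩
  refine ⟨hfin.toFinset.toList, ?_, fun w => by simp⟩
  intro w hw μ hμ ν _ hinv hlen
  simp only [Finset.mem_toList, Set.Finite.mem_toFinset, Set.mem_ofPred_eq] at hw ⊢
  obtain ⟨φ, -, rfl⟩ := hw
  obtain ⟨ψ, hψ⟩ := hinv.exists_mulEquiv
  -- Small substitutions involve only letters below `n`, so decoding loses nothing and the result is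
  -- again the code of an orbit element.
  have h1 := substHom_eq_codeHom (fun w hw => ((mem_smallSubsts.1 hμ).2 w hw).2) (φ u)
  rw [reduce_subst, FreeGroup.mk_toWord, h1, ← hψ] at hlen ⊢
  exact ⟨φ.trans ψ, by rwa [← norm_codeHom], rfl⟩

end Coding

/-! ### Soundness and existence of certificates. -/

section Decision

/-- Some automorphism maps the element represented by `u` into the subgroup generated by `gens`. -/
def OrbitMeets {n : ℕ} (u : GroupWord n) (gens : List (GroupWord n)) : Prop :=
  ∃ φ : FreeGroup (Fin n) ≃* FreeGroup (Fin n), φ (FreeGroup.mk u) ∈ subgroupOf gens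

variable {n : ℕ} {u : GroupWord n} {gens : List (GroupWord n)}

theorem mk_mem_subgroupOf {w : GroupWord n} (h : w ∈ gens) :
    FreeGroup.mk w ∈ subgroupOf gens :=
  Subgroup.subset_closure ⟨w, h, rfl⟩

theorem subgroupOf_le {K : Subgroup (FreeGroup (Fin n))}
    (h : ∀ w ∈ gens, FreeGroup.mk w ∈ K) : subgroupOf gens ≤ K := by
  rw [subgroupOf, Subgroup.closure_le]
  rintro _ ⟨w, hw, rfl⟩
  exact h w hw

/-- This lets a word in the indices of the generating list serve as a witness for membership in the
subgroup. -/
theorem range_substHom_code :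
    (substHom (gens.map GroupWord.code)).range = (subgroupOf gens).map (codeHom n) := by
  apply le_antisymm
  · apply FreeGroup.range_lift_le
    rintro _ ⟨i, rfl⟩
    by_cases hi : i < gens.length
    · simp only [List.getD_eq_getElem _ _ (show i < (gens.map GroupWord.code).length by simpa),
        List.getElem_map, mk_code]
      exact ⟨_, mk_mem_subgroupOf (List.getElem_mem hi), rfl⟩
    · simp only [List.getD_eq_default _ _
        (show (gens.map GroupWord.code).length ≤ i by simpa using hi)]
      exact one_mem _
  · rw [Subgroup.map_le_iff_le_comap]
    refine subgroupOf_le fun w hw => ?_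
    obtain ⟨i, hi, rfl⟩ := List.getElem_of_mem hw
    refine ⟨FreeGroup.of i, ?_⟩
    simp [substHom, hi, mk_code]

theorem exists_positiveCertificate_iff :
    (∃ c, PositiveCertificate (orbitInput n u gens) c) ↔ OrbitMeets u gens := by
  constructor
  · rintro ⟨⟨μ, ν, t⟩, hinv, heq⟩
    simp only [orbitInput] at hinv heq
    obtain ⟨φ, hφ⟩ := hinv.exists_mulEquiv
    rw [reduce_subst_code, reduce_subst, FreeGroup.toWord_inj] at heq
    refine ⟨φ, ?_⟩
    have : substHom (gens.map GroupWord.code) (FreeGroup.mk t) ∈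
        (subgroupOf gens).map (codeHom n) := by
      rw [← range_substHom_code]
      exact ⟨_, rfl⟩
    obtain ⟨x, hx, hx'⟩ := this
    rw [hφ, heq, ← hx', decodeHom_codeHom]
    exact hx
  · rintro ⟨φ, hφ⟩
    have : codeHom n (φ (FreeGroup.mk u)) ∈ (substHom (gens.map GroupWord.code)).range := by
      rw [range_substHom_code]
      exact ⟨_, hφ, rfl⟩
    obtain ⟨t, ht⟩ := this
    refine ⟨(codeAut φ, codeAut φ.symm, t.toWord), isInversePair_codeAut φ, ?_⟩
    simp only [orbitInput]
    rw [reduce_subst_code, reduce_subst, FreeGroup.mk_toWord, ht, substHom_codeAut]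

theorem substHom_singleton (h : List (ℕ × Bool)) (x : FreeGroup ℕ) :
    substHom [h] x ∈ Subgroup.zpowers (FreeGroup.mk h) := by
  have : (substHom [h]).range ≤ Subgroup.zpowers (FreeGroup.mk h) := by
    apply FreeGroup.range_lift_le
    rintro _ ⟨i, rfl⟩
    cases i with
    | zero => exact Subgroup.mem_zpowers _
    | succ i => exact one_mem _
  exact this ⟨x, rfl⟩

theorem mk_powerWord (k : ℕ) (b : Bool) :
    FreeGroup.mk (powerWord k b) = letter (0, b) ^ k := by
  induction k with
  | zero => rfl
  | succ k ih =>
    rw [pow_succ, ← ih, mk_mul_letter, powerWord, powerWord, List.range_succ, List.map_append]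
    rfl

theorem substHom_powerWord (h : List (ℕ × Bool)) (k : ℕ) :
    substHom [h] (FreeGroup.mk (powerWord k true)) = FreeGroup.mk h ^ k ∧
      substHom [h] (FreeGroup.mk (powerWord k false)) = (FreeGroup.mk h)⁻¹ ^ k := by
  rw [mk_powerWord, mk_powerWord, map_pow, map_pow, letter_false, letter_true, map_inv]
  simp [substHom]

theorem norm_mk_le_length (u : GroupWord n) : (FreeGroup.mk u).norm ≤ u.length :=
  FreeGroup.norm_mk_le

theorem length_code (u : GroupWord n) : u.code.length = u.length := by simp [GroupWord.code]

/-- The subgroup lies in the powers of one element `g`. If `φ u = g ^ k` with `g ≠ 1`, then `u` is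
the `k`-th power of the nontrivial element `φ⁻¹ g`, which bounds `k`; if `g = 1`, take `k = 0`. The
power then has norm at most `N`, so Whitehead's theorem places it in the closed list, which the
certificate excludes. -/
theorem not_orbitMeets_of_cyclicCertificate
    {c : List (ℕ × Bool) × List (List (ℕ × Bool)) × ℕ × List (List (ℕ × Bool))}
    (hc : CyclicCertificate (orbitInput n u gens) c) : ¬ OrbitMeets u gens := by
  obtain ⟨h, ts, N, S⟩ := c
  obtain ⟨⟨hh, hgens⟩, ⟨hN, hN'⟩, ⟨huS, hS⟩, hmiss⟩ := hc
  simp only [orbitInput, length_code] at hh hgens hN hN' huS hS hmiss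
  obtain ⟨g, hg⟩ := exists_codeHom_eq_mk hh
  rintro ⟨φ, hφ⟩
  have hle : subgroupOf gens ≤ Subgroup.zpowers g := by
    refine subgroupOf_le fun w hw => ?_
    have : FreeGroup.reduce w.code ∈ (gens.map GroupWord.code).map FreeGroup.reduce :=
      List.mem_map.2 ⟨_, List.mem_map.2 ⟨w, hw, rfl⟩, rfl⟩
    rw [hgens, List.mem_map] at this
    obtain ⟨t, -, ht⟩ := this
    rw [reduce_code, reduce_subst, FreeGroup.toWord_inj] at ht
    have h1 := substHom_singleton h (FreeGroup.mk t)
    rw [ht, ← hg] at h1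
    obtain ⟨k, hk⟩ := h1
    refine ⟨k, codeHom_injective n ?_⟩
    simpa using hk
  obtain ⟨k, hk⟩ := hle hφ
  simp only at hk
  -- the exponent can be chosen bounded
  obtain ⟨k, hk, hkb⟩ : ∃ k : ℤ, g ^ k = φ (FreeGroup.mk u) ∧ k.natAbs ≤ u.length := by
    by_cases hg1 : g = 1
    · exact ⟨0, by rw [← hk, hg1]; simp, by simp⟩
    · refine ⟨k, hk, ?_⟩
      have h1 : φ.symm g ≠ 1 := by simpa using hg1
      have h2 := natAbs_le_norm_zpow h1 k
      rw [← map_zpow, hk, MulEquiv.symm_apply_apply] at h2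
      exact h2.trans (norm_mk_le_length u)
  have hgn : g.norm ≤ h.length := by
    rw [← norm_codeHom, hg]; exact FreeGroup.norm_mk_le
  have hpow : ∃ b, substHom [h] (FreeGroup.mk (powerWord k.natAbs b)) =
      codeHom n (φ (FreeGroup.mk u)) := by
    rw [← hk, map_zpow, hg]
    rcases Int.natAbs_eq k with h' | h'
    · refine ⟨true, ?_⟩
      rw [(substHom_powerWord h _).1]
      conv_rhs => rw [h']
      rw [zpow_natCast]
    · refine ⟨false, ?_⟩
      rw [(substHom_powerWord h _).2]
      conv_rhs => rw [h']
      rw [zpow_neg, zpow_natCast, inv_pow]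
  have hnorm : (φ (FreeGroup.mk u)).norm ≤ N := by
    have h1 : (g ^ k).norm ≤ k.natAbs * g.norm := by
      rcases Int.natAbs_eq k with h' | h'
      · conv_lhs => rw [h']
        rw [zpow_natCast]
        exact freeGroup_norm_pow_le g _
      · conv_lhs => rw [h']
        rw [zpow_neg, zpow_natCast, FreeGroup.norm_inv_eq]
        exact freeGroup_norm_pow_le g _
    rw [← hk]
    exact h1.trans ((Nat.mul_le_mul hkb hgn).trans hN')
  rw [reduce_code] at huS
  have hmem := hS.mem_of_links huS (links_of_apply_eq φ ((norm_mk_le_length u).trans hN) hnorm)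
  obtain ⟨b, hb⟩ := hpow
  have h2 := hmiss k.natAbs (by rw [List.mem_range]; omega)
  rw [reduce_subst, reduce_subst] at h2
  cases b
  · rw [hb] at h2; exact h2.2 hmem
  · rw [hb] at h2; exact h2.1 hmem

theorem exists_cyclicCertificate (hcyc : IsCyclic (subgroupOf gens)) (hno : ¬ OrbitMeets u gens) :
    ∃ c, CyclicCertificate (orbitInput n u gens) c := by
  obtain ⟨g, hg⟩ := (Subgroup.isCyclic_iff_exists_zpowers_eq_top _).1 hcyc
  set h : List (ℕ × Bool) := GroupWord.code g.toWord with hh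
  have hmk : FreeGroup.mk h = codeHom n g := by rw [hh, mk_code, FreeGroup.mk_toWord]
  -- The sum is just a number that dominates both lengths required of the bound.
  obtain ⟨S, hS, hSm⟩ := exists_isClosedList_orbit (FreeGroup.mk u)
    (u.length + u.length * h.length)
  have hts : ∀ w ∈ gens, ∃ t, FreeGroup.reduce w.code = FreeGroup.reduce (subst [h] t) := by
    intro w hw
    have h1 := mk_mem_subgroupOf hw
    rw [← hg] at h1
    obtain ⟨k, hk⟩ := h1
    refine ⟨(FreeGroup.of 0 ^ k).toWord, ?_⟩
    rw [reduce_code, reduce_subst, FreeGroup.mk_toWord, ← hk, map_zpow, map_zpow, ← hmk]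
    simp [substHom]
  choose! t ht using hts
  refine ⟨(h, gens.map t, u.length + u.length * h.length, S), ⟨?_, ?_⟩, ⟨?_, ?_⟩, ⟨?_, hS⟩, ?_⟩
  · intro p hp
    simp only [hh, GroupWord.code, List.mem_map] at hp
    obtain ⟨q, -, rfl⟩ := hp
    exact q.1.2
  · simp only [orbitInput, List.map_map]
    exact List.map_congr_left fun w hw => ht w hw
  · simp only [orbitInput, length_code]; omega
  · simp only [orbitInput, length_code]; omega
  · rw [hSm]
    refine ⟨MulEquiv.refl _, ?_, by simp only [orbitInput, reduce_code]; rfl⟩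
    exact (norm_mk_le_length u).trans (Nat.le_add_right _ _)
  · intro k _
    rw [reduce_subst, reduce_subst, (substHom_powerWord h k).1, (substHom_powerWord h k).2]
    simp only [hSm, hmk, ← map_inv, ← map_pow, FreeGroup.toWord_inj]
    constructor
    · rintro ⟨φ, -, hφ⟩
      refine hno ⟨φ, ?_⟩
      rw [← codeHom_injective n hφ, ← hg]
      exact pow_mem (Subgroup.mem_zpowers g) k
    · rintro ⟨φ, -, hφ⟩
      refine hno ⟨φ, ?_⟩
      rw [← codeHom_injective n hφ, ← hg]
      exact pow_mem (inv_mem (Subgroup.mem_zpowers g)) k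

theorem decodeHom_mk_mem {R : List ℕ} {w : List (ℕ × Bool)} (h : ∀ p ∈ w, p.1 ∈ R) :
    decodeHom n (FreeGroup.mk w) ∈ Subgroup.closure (FreeGroup.of '' {i : Fin n | (i : ℕ) ∈ R}) := by
  induction w with
  | nil => exact one_mem _
  | cons a w ih =>
    rw [← letter_mul_mk, map_mul]
    refine mul_mem ?_ (ih fun p hp => h p (List.mem_cons_of_mem _ hp))
    have ha := h a List.mem_cons_self
    have hof : decodeHom n (FreeGroup.of a.1) ∈
        Subgroup.closure (FreeGroup.of '' {i : Fin n | (i : ℕ) ∈ R}) := by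
      simp only [decodeHom, FreeGroup.lift_apply_of]
      split_ifs with hi
      · exact Subgroup.subset_closure ⟨⟨a.1, hi⟩, ha, rfl⟩
      · exact one_mem _
    obtain ⟨i, b⟩ := a
    cases b
    · rw [letter_false, map_inv]; exact inv_mem hof
    · exact hof

/-- If `φ u` were in the subgroup, `θ (φ u)` would involve only letters of `R`, and then so would
some element linked to `u` within the norm of `u`. Its word is in the closed list, although every
word there has a letter outside `R`. -/
theorem not_orbitMeets_of_freeFactorCertificate
    {c : List (List (ℕ × Bool)) × List (List (ℕ × Bool)) × List ℕ × List (List (ℕ × Bool))}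
    (hc : FreeFactorCertificate (orbitInput n u gens) c) : ¬ OrbitMeets u gens := by
  obtain ⟨μ, ν, R, S⟩ := c
  obtain ⟨⟨hinv, hgens⟩, ⟨huS, hS⟩, hmiss⟩ := hc
  simp only [orbitInput] at hinv hgens huS hS hmiss
  rintro ⟨φ, hφ⟩
  obtain ⟨θ, hθ⟩ := hinv.exists_mulEquiv
  have hle : subgroupOf gens ≤
      (Subgroup.closure (FreeGroup.of '' {i : Fin n | (i : ℕ) ∈ R})).comap θ.toMonoidHom := by
    refine subgroupOf_le fun w hw => ?_
    have h1 := hgens w.code (List.mem_map.2 ⟨w, hw, rfl⟩)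
    rw [reduce_subst_code] at h1
    have h2 := decodeHom_mk_mem (n := n) h1
    rw [FreeGroup.mk_toWord, ← hθ] at h2
    exact h2
  have h1 : ∀ p ∈ ((φ.trans θ) (FreeGroup.mk u)).toWord, p.1 ∈ {i : Fin n | (i : ℕ) ∈ R} :=
    (letters_mem_iff _ _).2 (hle hφ)
  obtain ⟨y, hy, hyR⟩ := exists_links_of_letters_mem (φ.trans θ) h1
  rw [reduce_code] at huS hS
  change IsClosedList n (codeHom n (FreeGroup.mk u)).norm S at hS
  rw [norm_codeHom] at hS
  have hmem := hS.mem_of_links huS hy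
  obtain ⟨p, hp, hpR⟩ := hmiss _ hmem
  rw [toWord_codeHom, GroupWord.code, List.mem_map] at hp
  obtain ⟨q, hq, rfl⟩ := hp
  exact hpR (hyR q hq)

/-- The list of all orbit words of norm at most that of `u` works: if one of them used only letters
of `R`, following its automorphism by `θ⁻¹` would carry `u` into the free factor. -/
theorem exists_freeFactorCertificate (hff : IsFreeFactor (subgroupOf gens))
    (hno : ¬ OrbitMeets u gens) : ∃ c, FreeFactorCertificate (orbitInput n u gens) c := by
  classical
  obtain ⟨θ, R, hR⟩ := hff.exists_mulEquiv
  obtain ⟨S, hS, hSm⟩ := exists_isClosedList_orbit (FreeGroup.mk u) (FreeGroup.mk u).norm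
  have hRm : ∀ i : Fin n, (i : ℕ) ∈ R.toFinset.toList.map Fin.val ↔ i ∈ R := by
    intro i
    simp [Fin.val_inj]
  refine ⟨(codeAut θ, codeAut θ.symm, R.toFinset.toList.map Fin.val, S),
    ⟨isInversePair_codeAut θ, ?_⟩, ⟨?_, ?_⟩, ?_⟩
  · intro g hg p hp
    obtain ⟨w, hw, rfl⟩ := List.mem_map.1 hg
    simp only at hp
    rw [reduce_subst_code, substHom_codeAut, toWord_codeHom, GroupWord.code, List.mem_map] at hp
    obtain ⟨q, hq, rfl⟩ := hp
    have h1 := mk_mem_subgroupOf hw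
    rw [hR] at h1
    exact (hRm _).2 ((letters_mem_iff R _).2 h1 q hq)
  · rw [hSm]
    exact ⟨MulEquiv.refl _, le_rfl, by simp only [orbitInput, reduce_code]; rfl⟩
  · simp only [orbitInput, reduce_code]
    change IsClosedList n (codeHom n (FreeGroup.mk u)).norm S
    rwa [norm_codeHom]
  · intro w hw
    obtain ⟨φ, -, rfl⟩ := (hSm w).1 hw
    by_contra! hall
    refine hno ⟨φ.trans θ.symm, ?_⟩
    rw [hR, Subgroup.mem_comap]
    have h1 : φ (FreeGroup.mk u) ∈ Subgroup.closure (FreeGroup.of '' R) := by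
      rw [← letters_mem_iff]
      intro q hq
      rw [← hRm]
      refine hall (q.1, q.2) ?_
      rw [toWord_codeHom]
      exact List.mem_map.2 ⟨q, hq, rfl⟩
    simpa using h1

end Decision

/-! ### The algorithm. -/

/-- The certificates for the three kinds of answers. -/
abbrev Certificate : Type :=
  (List (List (ℕ × Bool)) × List (List (ℕ × Bool)) × List (ℕ × Bool)) ×
  (List (ℕ × Bool) × List (List (ℕ × Bool)) × ℕ × List (List (ℕ × Bool))) ×
  (List (List (ℕ × Bool)) × List (List (ℕ × Bool)) × List ℕ × List (List (ℕ × Bool)))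

theorem mainTheorem12 :
    ∃ f : OrbitInput →. Bool, Partrec f ∧
      ∀ (n : ℕ) (u : GroupWord n) (gens : List (GroupWord n)),
        (IsCyclic (subgroupOf gens) ∨ IsFreeFactor (subgroupOf gens)) →
          ∃ b ∈ f (orbitInput n u gens),
            (b = true ↔
              ∃ φ : FreeGroup (Fin n) ≃* FreeGroup (Fin n),
                φ (FreeGroup.mk u) ∈ subgroupOf gens) := by
  obtain ⟨f, hf, hsound, hdom⟩ := exists_partrec_search (α := OrbitInput) (σ := Bool) (β := Certificate)
    (R := fun x c => (c.1 = true ∧ PositiveCertificate x c.2.1) ∨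
      (c.1 = false ∧ (CyclicCertificate x c.2.2.1 ∨ FreeFactorCertificate x c.2.2.2))) (by
    have hc {β : Type} [Primcodable β] : Primrec fun p : OrbitInput × Bool × β => p.2.2 :=
      Primrec.snd.comp Primrec.snd
    have hb {β : Type} [Primcodable β] (b : Bool) :
        PrimrecPred fun p : OrbitInput × Bool × β => p.2.1 = b :=
      PrimrecPred.eq (Primrec.fst.comp Primrec.snd) (Primrec.const b)
    exact ((hb true).and (primrecRel_positiveCertificate.comp Primrec.fst
      (Primrec.fst.comp hc))).or ((hb false).and
        ((primrecRel_cyclicCertificate.comp Primrec.fst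
          (Primrec.fst.comp (Primrec.snd.comp hc))).or
        (primrecRel_freeFactorCertificate.comp Primrec.fst
          (Primrec.snd.comp (Primrec.snd.comp hc))))))
  refine ⟨f, hf, fun n u gens hH => ?_⟩
  -- Only termination depends on the subgroup being cyclic or a free factor. Components of the
  -- certificate that are not inspected are filled with defaults.
  have hd : (f (orbitInput n u gens)).Dom := by
    by_cases h : OrbitMeets u gens
    · obtain ⟨c, hc⟩ := exists_positiveCertificate_iff.2 h
      exact hdom _ true (c, default) (Or.inl ⟨rfl, hc⟩)
    · rcases hH with hH | hH
      · obtain ⟨c, hc⟩ := exists_cyclicCertificate hH h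
        exact hdom _ false (default, c, default) (Or.inr ⟨rfl, Or.inl hc⟩)
      · obtain ⟨c, hc⟩ := exists_freeFactorCertificate hH h
        exact hdom _ false (default, default, c) (Or.inr ⟨rfl, Or.inr hc⟩)
  refine ⟨_, Part.get_mem hd, ?_⟩
  obtain ⟨c, ⟨hb, hc⟩ | ⟨hb, hc⟩⟩ := hsound _ _ (Part.get_mem hd)
  · exact iff_of_true hb (exists_positiveCertificate_iff.1 ⟨_, hc⟩)
  · refine iff_of_false (by simp only at hb; simp [hb]) ?_
    rcases hc with hc | hc
    · exact not_orbitMeets_of_cyclicCertificate hc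
    · exact not_orbitMeets_of_freeFactorCertificate hc
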